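/- A Shapley-value weighted congestion game has a finite non-empty set $N$ of $n$ players with weights $w_i>0$, a finite set $E$ of resources, non-empty strategy sets $\mathcal P_i\subseteq 2^E$ and resource cost functions $c_e$. In an outcome $P=(P_i)_{i\in N}$, $P_i\in\mathcal P_i$, let $S_e(P)=\{i: e\in P_i\}$ and $C_e(x)=x\,c_e(x)$. Player $i$ pays $X_i(P)=\sum_{e\in P_i}\chi_e(i,S_e(P))$, where the Shapley share $\chi_e(i,A)$ is the expected value of $C_e(W+w_i)-C_e(W)$, with $W$ the total weight of the players preceding $i$ in a uniformly random ordering of $A$. A $\rho$-move of $i$ in $P$ exists if $X_i(P)>\rho X_i(P_{-i},P_i')$ for some $P_i'\in\mathcal P_i$; $P$ is a $\rho$-approximate pure Nash equilibrium if no player has a $\rho$-move. Let $d\ge 1$ and let all $c_e$ be polynomials of degree at most $d$ with non-negative coefficients. Let $P^0$ be an initial outcome, $X_{\max}=\max_i X_i(P^0)$, and let $X_{\min}$ be the minimum over $i$ of the cost of $i$ when only $i$ participates and plays her best strategy; assume $X_{\min}>0$. For $\gamma>0$ put $t=1+\gamma$, $$\Theta=\frac{(d+1)^2(d+3)}{8}\cdot\frac{t\,(2^{1/(d+1)}-1)^{-d}}{2^{-d/(d+1)}(1+t)-t},\qquad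 s=\Bigl(\frac1\Theta-2\gamma\Bigr)^{-1},$$ $g=2n(d+1)\gamma^{-3}$, $b_r=X_{\max}\,g^{-r}$ and $m=\lceil\ln(X_{\max}/X_{\min})\rceil$, and assume $\Theta>0$ and $\gamma<\frac1{2\Theta}$. The phased best-response algorithm starts in $P^0$ with no finished players. In the initial phase, as long as some player with cost at least $b_1$ has a $t$-move, such a player switches to a best response. Then, for $r=1,\dots,m-1$: as long as some non-finished player either has cost at least $b_r$ and an $s$-move, or has cost in $[b_{r+1},b_r]$ and a $t$-move, such a player switches to a best response; when there is no such player, all players with cost at least $b_r$ become finished. The choices of moving players and of best responses are arbitrary; each switch is one improvement step. **Theorem.** There are a univariate polynomial $p$ and a polynomial $q$ in four variables such that for all such games, $d$, $\gamma$ and $P^0$, every execution of the algorithm terminates, after at most $q\bigl(n,d,1/\gamma,\ln(X_{\max}/X_{\min})\bigr)$ improvement steps, and if moreover $\gamma\le\frac1{4\Theta}$, then the state in which it terminates is an $\alpha$-approximate pure Nash equilibrium with $\alpha=\bigl(\frac{d}{\ln 2}\bigr)^d p(d)$. -/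

import Mathlib

/-- A weighted congestion game with set of players `N` and set of resources `E`: positive weights,
non-empty strategy sets `𝒫 i ⊆ 2^E`, and polynomial resource costs with non-negative
coefficients. The players pay Shapley cost shares, see `playerCost`. -/
structure CongestionGame (N E : Type*) where
  weight : N → ℝ
  weight_pos : ∀ i, 0 < weight i
  strategies : N → Finset (Finset E)
  strategies_nonempty : ∀ i, (strategies i).Nonempty
  cost : E → Polynomial ℝ
  cost_coeff_nonneg : ∀ e k, 0 ≤ (cost e).coeff k

namespace CongestionGame

variable {N E : Type*} [Fintype N] [DecidableEq N] [DecidableEq E]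

/-- A profile `P` is an outcome of the game if every player uses one of her strategies. -/
def IsOutcome (G : CongestionGame N E) (P : N → Finset E) : Prop :=
  ∀ i, P i ∈ G.strategies i

/-- The joint cost `C_e(x) = x · c_e(x)`. -/
noncomputable def jointCost (G : CongestionGame N E) (e : E) (x : ℝ) : ℝ :=
  x * (G.cost e).eval x

/-- The set `S_e(P)` of users of the resource `e`. -/
def users (P : N → Finset E) (e : E) : Finset N :=
  Finset.univ.filter fun i => e ∈ P i

/-- `W_A^{<i,π}`: the total weight of the members of `A` that precede `i` in the ordering `π`. -/
noncomputable def precedingWeight (G : CongestionGame N E) (A : Finset N)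
    (π : A ≃ Fin A.card) (i : A) : ℝ :=
  ∑ j ∈ Finset.univ.filter (fun j : A => π j < π i), G.weight j

/-- The Shapley cost share `χ_e(i, A)` of player `i ∈ A`: her expected marginal contribution to
the joint cost of `e` when the players in `A` are ordered uniformly at random. -/
noncomputable def shapleyShare (G : CongestionGame N E) (e : E) (i : N) (A : Finset N) : ℝ :=
  if hi : i ∈ A then
    (∑ π : A ≃ Fin A.card,
      (G.jointCost e (G.precedingWeight A π ⟨i, hi⟩ + G.weight i)
        - G.jointCost e (G.precedingWeight A π ⟨i, hi⟩))) / (Fintype.card (A ≃ Fin A.card) : ℝ)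
  else 0

/-- The total cost `X_i(P)` of player `i`. -/
noncomputable def playerCost (G : CongestionGame N E) (P : N → Finset E) (i : N) : ℝ :=
  ∑ e ∈ P i, G.shapleyShare e i (users P e)

/-- Player `i` can perform a `ρ`-move in `P`: some strategy improves her cost by more than a
factor `ρ`. -/
def HasMove (G : CongestionGame N E) (ρ : ℝ) (P : N → Finset E) (i : N) : Prop :=
  ∃ S ∈ G.strategies i, ρ * G.playerCost (Function.update P i S) i < G.playerCost P i

/-- `P` is a `ρ`-approximate pure Nash equilibrium. -/
def IsApproxPNE (G : CongestionGame N E) (ρ : ℝ) (P : N → Finset E) : Prop :=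
  G.IsOutcome P ∧ ∀ i, ∀ S ∈ G.strategies i,
    G.playerCost P i ≤ ρ * G.playerCost (Function.update P i S) i

/-- `S` is a best response of player `i` to the profile `P`. -/
def IsBestResponse (G : CongestionGame N E) (P : N → Finset E) (i : N) (S : Finset E) : Prop :=
  S ∈ G.strategies i ∧ ∀ S' ∈ G.strategies i,
    G.playerCost (Function.update P i S) i ≤ G.playerCost (Function.update P i S') i

/-- `X_max`: the maximum cost among all players in the profile `P`. -/
noncomputable def maxCost (G : CongestionGame N E) (P : N → Finset E) : ℝ :=
  ⨆ i, G.playerCost P i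

/-- `X_min`: the minimum, over all players `i`, of the cost of `i` when only player `i`
participates in the game and plays her best strategy. -/
noncomputable def minCost (G : CongestionGame N E) : ℝ :=
  ⨅ i, ⨅ S : G.strategies i, G.playerCost (Function.update (fun _ => ∅) i S) i

end CongestionGame

/-- The upper bound
`(d+1)²(d+3)/8 · ρ (2^{1/(d+1)} - 1)^{-d} / (2^{-d/(d+1)} (1+ρ) - ρ)` on the `ρ`-stretch. -/
noncomputable def stretchBound (d : ℕ) (ρ : ℝ) : ℝ :=
  ((d : ℝ) + 1) ^ 2 * ((d : ℝ) + 3) / 8 *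
    (ρ * (((2 : ℝ) ^ (1 / ((d : ℝ) + 1)) - 1) ^ d)⁻¹ /
      ((2 : ℝ) ^ (-(d : ℝ) / ((d : ℝ) + 1)) * (1 + ρ) - ρ))

namespace PhasedBestResponse

variable {N E : Type*} [Fintype N] [DecidableEq N] [DecidableEq E]

/-- The factor `t = 1 + γ`. -/
def tFactor (γ : ℝ) : ℝ := 1 + γ

/-- The factor `s = (1/Θ - 2γ)⁻¹`, where `Θ` is the stretch bound at `t`. -/
noncomputable def sFactor (d : ℕ) (γ : ℝ) : ℝ :=
  (1 / stretchBound d (tFactor γ) - 2 * γ)⁻¹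

/-- The block ratio `g = 2 n (d+1) γ^{-3}` for `n` players. -/
noncomputable def blockRatio (n d : ℕ) (γ : ℝ) : ℝ :=
  2 * (n : ℝ) * ((d : ℝ) + 1) * (γ ^ 3)⁻¹

/-- The block border `b_r = X_max · g^{-r}`, where `P₀` is the initial state. -/
noncomputable def border (G : CongestionGame N E) (d : ℕ) (γ : ℝ) (P₀ : N → Finset E) (r : ℕ) :
    ℝ :=
  G.maxCost P₀ * (blockRatio (Fintype.card N) d γ ^ r)⁻¹

/-- The number of blocks `m = log (X_max / X_min)`, rounded up. -/
noncomputable def numBlocks (G : CongestionGame N E) (P₀ : N → Finset E) : ℕ :=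
  ⌈Real.log (G.maxCost P₀ / G.minCost)⌉₊

/-- A configuration of the algorithm: the current phase (phase `0` is the initial while-loop), the
current state of the game, the set of finished players, and the number of improvement steps
performed so far. -/
structure Config (N E : Type*) where
  phase : ℕ
  state : N → Finset E
  finished : Finset N
  steps : ℕ

/-- The configuration in which the algorithm starts. -/
def initial (P₀ : N → Finset E) : Config N E := ⟨0, P₀, ∅, 0⟩

/-- The algorithm has completed the initial phase and the phases `1, …, m - 1`. -/
def Halted (G : CongestionGame N E) (P₀ : N → Finset E) (c : Config N E) : Prop :=
  numBlocks G P₀ - 1 < c.phase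

/-- The condition of the while-loops: player `i` is allowed to move in configuration `c`. -/
def Eligible (G : CongestionGame N E) (d : ℕ) (γ : ℝ) (P₀ : N → Finset E) (c : Config N E)
    (i : N) : Prop :=
  (c.phase = 0 ∧ border G d γ P₀ 1 ≤ G.playerCost c.state i ∧
    G.HasMove (tFactor γ) c.state i) ∨
  (1 ≤ c.phase ∧ i ∉ c.finished ∧
    ((border G d γ P₀ c.phase ≤ G.playerCost c.state i ∧ G.HasMove (sFactor d γ) c.state i) ∨
     (border G d γ P₀ (c.phase + 1) ≤ G.playerCost c.state i ∧
      G.playerCost c.state i ≤ border G d γ P₀ c.phase ∧ G.HasMove (tFactor γ) c.state i)))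

open Classical in
/-- The set of finished players after the phase of `c` has ended in configuration `c`: in the
phases `r ≥ 1` all players of cost at least `b_r` are added. -/
noncomputable def finishedAfter (G : CongestionGame N E) (d : ℕ) (γ : ℝ) (P₀ : N → Finset E)
    (c : Config N E) : Finset N :=
  if c.phase = 0 then c.finished
  else c.finished ∪ Finset.univ.filter fun i => border G d γ P₀ c.phase ≤ G.playerCost c.state i

/-- The transitions of the algorithm. As long as there is an eligible player, one of them (any)
switches to one of her best responses (any), which counts as one improvement step; when there is
none, the algorithm proceeds to the next phase. -/
inductive Step (G : CongestionGame N E) (d : ℕ) (γ : ℝ) (P₀ : N → Finset E) :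
    Config N E → Config N E → Prop
  | improve (c : Config N E) (i : N) (S : Finset E) (running : ¬ Halted G P₀ c)
      (eligible : Eligible G d γ P₀ c i) (best : G.IsBestResponse c.state i S) :
      Step G d γ P₀ c
        ⟨c.phase, Function.update c.state i S, c.finished, c.steps + 1⟩
  | nextPhase (c : Config N E) (running : ¬ Halted G P₀ c)
      (none_eligible : ∀ i, ¬ Eligible G d γ P₀ c i) :
      Step G d γ P₀ c
        ⟨c.phase + 1, c.state, finishedAfter G d γ P₀ c, c.steps⟩

/-- `c` is reached by some execution of the algorithm that starts in the state `P₀`. -/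
def Reachable (G : CongestionGame N E) (d : ℕ) (γ : ℝ) (P₀ : N → Finset E) (c : Config N E) :
    Prop :=
  Relation.ReflTransGen (Step G d γ P₀) (initial P₀) c

end PhasedBestResponse

/-! Write the cost-sharing game on each resource in its Harsanyi dividends. The dividend of a
coalition `T` is the iterated forward difference at `0` of `x·c_e(x)` in the weights of `T`. It is
non-negative because the coefficients are, and it vanishes when `T` has more than `d+1` members.
Each member receives an equal part of it, so the Shapley share of `i` is the sum of `dividend T /
|T|` over the coalitions of users that contain `i` (`shapleyShare_eq_dividendShare`). With `val`
summing these terms over a class of coalitions, the cost of `i` is the value of the coalitions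
containing `i`, and the partial potential of `R` is the value of those meeting `R`. Exactness of the
potential and locality (coalitions without movers keep their value) are then immediate.

Weighted Jensen inequalities for the difference polynomials give smoothness
(`sum_playerCost_update_le`). With `l = 2^{1/(d+1)} - 1` this bounds the stretch: if the players of
`D` are in `t`-equilibrium up to an additive slack, their partial potential is at most `Θ` times
that of any profile reached by moving only `D`, plus slack (`partialPotential_le_stretchBound_mul`).

Let `R` be the players moving in phase `r`. Charging each coalition to its last mover bounds the
final partial potential of `R` by `(drop)/(s-1) + |R| b_r`. The phase starts in a `t`-equilibrium
for `R` up to slack `b_r`. As `1/s = 1/Θ - 2γ`, the two bounds force the initial partial potential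
of `R` to be at most `|R| b_r/γ` (`MoveHistory.partialPotential_start_le`). This has two
consequences. Each step lowers the potential by at least `γ/(1+γ)·b_{r+1}`, so a phase has
polynomially many steps. And since the borders decrease geometrically, all phases after a player has
finished disturb her cost and her alternatives only by a small fraction of her cost, so her lack of
`s`-moves survives as a `16Θ`-approximation (`FinishedInv.playerCost_le`). Players never finished
cost at least `X_min ≥ b_m` and have no `t`-move. Finally `16Θ` is estimated by `(d/ln 2)^d` times a
polynomial (`stretchBound_le`). -/

/-! ### Polynomials with non-negative coefficients and their iterated differences. -/

open Polynomial in
theorem Polynomial.coeff_zero_le_eval {p : Polynomial ℝ} (hp : ∀ k, 0 ≤ p.coeff k) {r : ℝ}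
    (hr : 0 ≤ r) : p.coeff 0 ≤ p.eval r := by
  rw [eval_eq_sum_range]
  have := Finset.single_le_sum (s := Finset.range (p.natDegree + 1))
    (f := fun i => p.coeff i * r ^ i) (fun i _ => mul_nonneg (hp i) (pow_nonneg hr i))
    (Finset.mem_range.2 (Nat.succ_pos _))
  simpa using this

open Polynomial in
theorem Polynomial.coeff_hasseDeriv_nonneg {p : Polynomial ℝ} (hp : ∀ k, 0 ≤ p.coeff k) (n k : ℕ) :
    0 ≤ (hasseDeriv n p).coeff k := by
  rw [hasseDeriv_coeff]
  exact mul_nonneg (Nat.cast_nonneg _) (hp _)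

open Polynomial in
theorem Polynomial.coeff_taylor_sub_nonneg {p : Polynomial ℝ} (hp : ∀ k, 0 ≤ p.coeff k) {r : ℝ}
    (hr : 0 ≤ r) (k : ℕ) : 0 ≤ (taylor r p - p).coeff k := by
  rw [coeff_sub, taylor_coeff, sub_nonneg]
  have h := coeff_zero_le_eval (coeff_hasseDeriv_nonneg hp k) hr
  rw [hasseDeriv_coeff] at h
  simpa using h

-- A shift preserves the top coefficient, so a forward difference loses one degree. Speaking of
-- coefficients instead of degrees lets `m = 0` express that the difference of a constant is zero.
open Polynomial in
theorem Polynomial.coeff_taylor_sub_eq_zero {p : Polynomial ℝ} {m : ℕ}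
    (hp : ∀ k, m < k → p.coeff k = 0) (r : ℝ) {k : ℕ} (hk : m ≤ k) :
    (taylor r p - p).coeff k = 0 := by
  rw [coeff_sub, taylor_coeff, eval_eq_sum_range, Finset.sum_eq_single 0]
  · simp [hasseDeriv_coeff]
  · intro l _ hl
    rw [hasseDeriv_coeff, hp _ (by omega)]
    simp
  · simp

/-- The iterated forward difference of the polynomial `p` in the steps `w j`, `j ∈ G`. -/
noncomputable def iterDiff {N : Type*} [DecidableEq N] (w : N → ℝ) (p : Polynomial ℝ)
    (G : Finset N) : Polynomial ℝ :=
  ∑ S ∈ G.powerset, (-1 : ℝ) ^ (G \ S).card • Polynomial.taylor (∑ j ∈ S, w j) p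

section IterDiff

variable {N : Type*} [DecidableEq N] {w : N → ℝ} {p : Polynomial ℝ}

theorem iterDiff_empty : iterDiff w p ∅ = p := by
  simp [iterDiff]

theorem iterDiff_insert {z : N} {G : Finset N} (hz : z ∉ G) :
    iterDiff w p (insert z G) = Polynomial.taylor (w z) (iterDiff w p G) - iterDiff w p G := by
  have h1 : ∀ S ∈ G.powerset, (-1 : ℝ) ^ (insert z G \ S).card
      • Polynomial.taylor (∑ j ∈ S, w j) p
      = - ((-1 : ℝ) ^ (G \ S).card • Polynomial.taylor (∑ j ∈ S, w j) p) := by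
    intro S hS
    have hzS : z ∉ S := fun h => hz (Finset.mem_powerset.1 hS h)
    rw [Finset.insert_sdiff_of_notMem _ hzS, Finset.card_insert_of_notMem (by simp [hz]),
      pow_succ, mul_neg_one, neg_smul]
  have h2 : ∀ S ∈ G.powerset, (-1 : ℝ) ^ (insert z G \ insert z S).card
      • Polynomial.taylor (∑ j ∈ insert z S, w j) p
      = Polynomial.taylor (w z) ((-1 : ℝ) ^ (G \ S).card
        • Polynomial.taylor (∑ j ∈ S, w j) p) := by
    intro S hS
    have hzS : z ∉ S := fun h => hz (Finset.mem_powerset.1 hS h)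
    have : insert z G \ insert z S = G \ S := by
      ext x
      simp only [Finset.mem_sdiff, Finset.mem_insert]
      constructor
      · rintro ⟨h | h, h'⟩
        · exact absurd (Or.inl h) h'
        · exact ⟨h, fun h'' => h' (Or.inr h'')⟩
      · rintro ⟨h, h'⟩
        exact ⟨Or.inr h, fun h'' => h''.elim (fun e => hz (e ▸ h)) h'⟩
    rw [this, Finset.sum_insert hzS, map_smul, Polynomial.taylor_taylor]
  rw [iterDiff, Finset.sum_powerset_insert hz, Finset.sum_congr rfl h1, Finset.sum_congr rfl h2,
    Finset.sum_neg_distrib, ← map_sum, ← iterDiff]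
  ring

theorem iterDiff_coeff_nonneg (hw : ∀ i, 0 ≤ w i) (hp : ∀ k, 0 ≤ p.coeff k) (G : Finset N)
    (k : ℕ) : 0 ≤ (iterDiff w p G).coeff k := by
  induction G using Finset.induction_on generalizing k with
  | empty => rw [iterDiff_empty]; exact hp k
  | insert z G hz ih =>
    rw [iterDiff_insert hz]
    exact Polynomial.coeff_taylor_sub_nonneg ih (hw z) k

theorem iterDiff_coeff_eq_zero {m : ℕ} (hp : ∀ k, m < k → p.coeff k = 0) (G : Finset N) (k : ℕ)
    (hk : m < k + G.card) : (iterDiff w p G).coeff k = 0 := by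
  induction G using Finset.induction_on generalizing k with
  | empty => rw [iterDiff_empty]; exact hp k (by simpa using hk)
  | insert z G hz ih =>
    rw [Finset.card_insert_of_notMem hz] at hk
    rw [iterDiff_insert hz]
    by_cases h : G.card ≤ m
    · exact Polynomial.coeff_taylor_sub_eq_zero (m := m - G.card)
        (fun l hl => ih l (by omega)) _ (by omega)
    -- Once `G` has more than `m` elements the difference is already the zero polynomial; truncated
    -- subtraction would hide this.
    · exact Polynomial.coeff_taylor_sub_eq_zero (m := 0)
        (fun l hl => ih l (by omega)) _ (by omega)

/-- Möbius inversion: a shift is the identity plus a difference, and expanding the product of these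
over `U` gives one iterated difference per subset. -/
theorem sum_powerset_iterDiff {G U : Finset N} (h : Disjoint G U) :
    ∑ H ∈ U.powerset, (iterDiff w p (G ∪ H)).eval 0 = (iterDiff w p G).eval (∑ j ∈ U, w j) := by
  induction U using Finset.induction_on generalizing G with
  | empty => simp
  | insert z U hz ih =>
    rw [Finset.disjoint_insert_right] at h
    rw [Finset.sum_powerset_insert hz, ih h.2]
    have : ∀ H : Finset N, G ∪ insert z H = insert z G ∪ H := fun H => by
      rw [Finset.union_insert, Finset.insert_union]
    simp only [this]
    rw [ih (by rw [Finset.disjoint_insert_left]; exact ⟨hz, h.2⟩), iterDiff_insert h.1,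
      Polynomial.eval_sub, Polynomial.taylor_eval, Finset.sum_insert hz, add_comm (w z)]
    ring

end IterDiff

theorem sum_powerset_union {N M : Type*} [DecidableEq N] [AddCommMonoid M] {Z U : Finset N}
    (h : Disjoint Z U) (F : Finset N → M) :
    ∑ T ∈ (Z ∪ U).powerset, F T = ∑ G ∈ Z.powerset, ∑ H ∈ U.powerset, F (G ∪ H) := by
  induction U using Finset.induction_on generalizing F with
  | empty => simp
  | insert z U hz ih =>
    rw [Finset.disjoint_insert_right] at h
    rw [Finset.union_insert, Finset.sum_powerset_insert (by simp [h.1, hz]), ih h.2, ih h.2,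
      ← Finset.sum_add_distrib]
    refine Finset.sum_congr rfl fun G _ => ?_
    rw [Finset.sum_powerset_insert hz]
    simp only [Finset.union_insert]

/-- Jensen's inequality for `x^(n+1)` at the points `(1+l)a` and `((1+l)/l)b` with weights `1/(1+l)`
and `l/(1+l)`. -/
theorem add_pow_succ_le_weighted {l a b : ℝ} (hl : 0 < l) (ha : 0 ≤ a) (hb : 0 ≤ b) (n : ℕ) :
    (a + b) ^ (n + 1) ≤ (1 + l) ^ n * a ^ (n + 1) + ((1 + l) / l) ^ n * b ^ (n + 1) := by
  have h1l : 0 < 1 + l := by linarith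
  have hx : (1 + l) * a ∈ Set.Ici (0 : ℝ) := Set.mem_Ici.2 (by positivity)
  have hy : (1 + l) / l * b ∈ Set.Ici (0 : ℝ) := Set.mem_Ici.2 (by positivity)
  have hp : 0 ≤ 1 / (1 + l) := by positivity
  have hq : 0 ≤ l / (1 + l) := by positivity
  have hpq : 1 / (1 + l) + l / (1 + l) = 1 := by field_simp
  have hc : ConvexOn ℝ (Set.Ici 0) fun x : ℝ => x ^ (n + 1) := convexOn_pow (n + 1)
  have := hc.2 hx hy hp hq hpq
  simp only [smul_eq_mul] at this
  calc (a + b) ^ (n + 1)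
      = (1 / (1 + l) * ((1 + l) * a) + l / (1 + l) * ((1 + l) / l * b)) ^ (n + 1) := by
        congr 1; field_simp
    _ ≤ _ := this
    _ = _ := by
        rw [mul_pow, mul_pow, pow_succ (1 + l), pow_succ ((1 + l) / l)]
        field_simp

/-- Removing the constant term leaves exponents `k+1 ≤ d+1`, and the weighted inequality for `k+1`
has factors of exponent only `k ≤ d`. -/
theorem Polynomial.eval_add_sub_le {p : Polynomial ℝ} (hp : ∀ k, 0 ≤ p.coeff k) {d : ℕ}
    (hd : ∀ k, d + 1 < k → p.coeff k = 0) {l a b : ℝ} (hl : 0 < l) (ha : 0 ≤ a) (hb : 0 ≤ b) :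
    p.eval (a + b) - p.eval 0 ≤ (1 + l) ^ d * (p.eval a - p.eval 0)
      + ((1 + l) / l) ^ d * (p.eval b - p.eval 0) := by
  have key : ∀ x : ℝ, p.eval x - p.eval 0
      = ∑ k ∈ Finset.range (d + 1), p.coeff (k + 1) * x ^ (k + 1) := by
    intro x
    have hn : p.natDegree < d + 1 + 1 := by
      rw [Nat.lt_succ_iff, Polynomial.natDegree_le_iff_coeff_eq_zero]
      exact fun k hk => hd k hk
    rw [Polynomial.eval_eq_sum_range' hn, Polynomial.eval_eq_sum_range' hn,
      Finset.sum_range_succ', Finset.sum_range_succ' (fun i => p.coeff i * 0 ^ i)]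
    simp
  rw [key, key, key, Finset.mul_sum, Finset.mul_sum, ← Finset.sum_add_distrib]
  refine Finset.sum_le_sum fun k hk => ?_
  have hkd : k ≤ d := Nat.lt_succ_iff.1 (Finset.mem_range.1 hk)
  have h1 : (1 + l) ^ k ≤ (1 + l) ^ d := pow_le_pow_right₀ (by linarith) hkd
  have h2 : ((1 + l) / l) ^ k ≤ ((1 + l) / l) ^ d :=
    pow_le_pow_right₀ ((one_le_div hl).2 (by linarith)) hkd
  have h3 := add_pow_succ_le_weighted hl ha hb k
  have h4 := mul_le_mul_of_nonneg_right h1 (pow_nonneg ha (k + 1))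
  have h5 := mul_le_mul_of_nonneg_right h2 (pow_nonneg hb (k + 1))
  have := mul_le_mul_of_nonneg_left (h3.trans (add_le_add h4 h5)) (hp (k + 1))
  linarith

/-- Polynomials with non-negative coefficients have increasing differences. -/
theorem Polynomial.eval_add_sub_mono {p : Polynomial ℝ} (hp : ∀ k, 0 ≤ p.coeff k) {x y h : ℝ}
    (hx : 0 ≤ x) (hxy : x ≤ y) (hh : 0 ≤ h) :
    p.eval (x + h) - p.eval x ≤ p.eval (y + h) - p.eval y := by
  have hq := Polynomial.coeff_taylor_sub_nonneg hp hh
  have e : ∀ z, p.eval (z + h) - p.eval z = (taylor h p - p).eval z := fun z => by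
    rw [eval_sub, taylor_eval]
  rw [e, e, eval_eq_sum_range, eval_eq_sum_range]
  refine Finset.sum_le_sum fun k _ => mul_le_mul_of_nonneg_left ?_ (hq k)
  exact pow_le_pow_left₀ hx hxy k

/-- Adding the weights one after another only enlarges each increment, by increasing differences. -/
theorem Polynomial.sum_eval_add_sub_le {ι : Type*} {p : Polynomial ℝ} (hp : ∀ k, 0 ≤ p.coeff k)
    {a : ℝ} (ha : 0 ≤ a) {w : ι → ℝ} (hw : ∀ i, 0 ≤ w i) (B : Finset ι) :
    ∑ i ∈ B, (p.eval (a + w i) - p.eval a) ≤ p.eval (a + ∑ i ∈ B, w i) - p.eval a := by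
  classical
  induction B using Finset.induction_on with
  | empty => simp
  | insert z B hz ih =>
    rw [Finset.sum_insert hz, Finset.sum_insert hz]
    have := Polynomial.eval_add_sub_mono hp ha
      (y := a + ∑ i ∈ B, w i) (by linarith [Finset.sum_nonneg fun i (_ : i ∈ B) => hw i]) (hw z)
    rw [show a + (w z + ∑ i ∈ B, w i) = a + ∑ i ∈ B, w i + w z by ring]
    linarith

/-! ### Random orderings and Harsanyi dividends. -/

/-- The events "`j` comes last among `T`", for `j ∈ T`, partition the orderings, and transpositions
of `T` show that they are equally large. -/
theorem card_equiv_max_mul_card {α : Type*} [Fintype α] [DecidableEq α] {n : ℕ} {T : Finset α}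
    {i : α} (hi : i ∈ T) :
    (Finset.univ.filter fun π : α ≃ Fin n => ∀ h ∈ T, π h ≤ π i).card * T.card
      = Fintype.card (α ≃ Fin n) := by
  let L : α → Finset (α ≃ Fin n) := fun j => Finset.univ.filter fun π => ∀ h ∈ T, π h ≤ π j
  have hL : ∀ j ∈ T, (L j).card = (L i).card := by
    intro j hj
    have hsw : ∀ h ∈ T, Equiv.swap i j h ∈ T := by
      intro h hh
      rcases eq_or_ne h i with rfl | h1
      · rwa [Equiv.swap_apply_left]
      rcases eq_or_ne h j with rfl | h2
      · rwa [Equiv.swap_apply_right]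
      rwa [Equiv.swap_apply_of_ne_of_ne h1 h2]
    refine Finset.card_bij' (fun π _ => (Equiv.swap i j).trans π)
      (fun π _ => (Equiv.swap i j).trans π) ?_ ?_ ?_ ?_
    · intro π hπ
      simp only [L, Finset.mem_filter, Finset.mem_univ, true_and, Equiv.trans_apply,
        Equiv.swap_apply_left] at hπ ⊢
      exact fun h hh => hπ _ (hsw h hh)
    · intro π hπ
      simp only [L, Finset.mem_filter, Finset.mem_univ, true_and, Equiv.trans_apply,
        Equiv.swap_apply_right] at hπ ⊢
      exact fun h hh => hπ _ (hsw h hh)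
    · intro π _
      ext x
      simp
    · intro π _
      ext x
      simp
  have hdisj : (T : Set α).PairwiseDisjoint L := by
    intro j hj k hk hjk
    rw [Function.onFun, Finset.disjoint_left]
    intro π hπj hπk
    simp only [L, Finset.mem_filter, Finset.mem_univ, true_and] at hπj hπk
    exact hjk (π.injective (le_antisymm (hπk j hj) (hπj k hk)))
  have hunion : T.biUnion L = Finset.univ := by
    refine Finset.eq_univ_of_forall fun π => ?_
    obtain ⟨j, hj, hmax⟩ := T.exists_max_image π ⟨i, hi⟩
    exact Finset.mem_biUnion.2 ⟨j, hj, by simpa [L] using hmax⟩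
  have := Finset.card_biUnion hdisj
  rw [hunion, Finset.sum_congr rfl hL, Finset.sum_const, smul_eq_mul, Finset.card_univ] at this
  rw [this, mul_comm]

namespace CongestionGame

section Dividend

variable {N E : Type*}

/-- The polynomial `x · c_e(x)`. -/
noncomputable def jointPoly (G : CongestionGame N E) (e : E) : Polynomial ℝ :=
  Polynomial.X * G.cost e

theorem jointPoly_coeff_nonneg (G : CongestionGame N E) (e : E) (k : ℕ) :
    0 ≤ (G.jointPoly e).coeff k := by
  cases k with
  | zero => simp [jointPoly]
  | succ k => rw [jointPoly, Polynomial.coeff_X_mul]; exact G.cost_coeff_nonneg e k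

theorem jointPoly_coeff_eq_zero {G : CongestionGame N E} {e : E} {d : ℕ}
    (hd : (G.cost e).natDegree ≤ d) (k : ℕ) (hk : d + 1 < k) : (G.jointPoly e).coeff k = 0 := by
  cases k with
  | zero => omega
  | succ k =>
    rw [jointPoly, Polynomial.coeff_X_mul]
    exact Polynomial.coeff_eq_zero_of_natDegree_lt (by omega)

variable [DecidableEq N]

/-- The Harsanyi dividend of the coalition `T` in the cost-sharing game on the resource `e`. -/
noncomputable def dividend (G : CongestionGame N E) (e : E) (T : Finset N) : ℝ :=
  (iterDiff G.weight (G.jointPoly e) T).eval 0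

theorem iterDiff_jointPoly_coeff_nonneg (G : CongestionGame N E) (e : E) (T : Finset N) (k : ℕ) :
    0 ≤ (iterDiff G.weight (G.jointPoly e) T).coeff k :=
  iterDiff_coeff_nonneg (fun i => (G.weight_pos i).le) (G.jointPoly_coeff_nonneg e) T k

theorem dividend_nonneg (G : CongestionGame N E) (e : E) (T : Finset N) : 0 ≤ G.dividend e T := by
  have := G.iterDiff_jointPoly_coeff_nonneg e T 0
  rwa [Polynomial.coeff_zero_eq_eval_zero] at this

theorem term_nonneg (G : CongestionGame N E) (e : E) (T : Finset N) :
    0 ≤ G.dividend e T / T.card :=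
  div_nonneg (G.dividend_nonneg e T) (Nat.cast_nonneg _)

theorem dividend_eq_zero {G : CongestionGame N E} {e : E} {d : ℕ}
    (hd : (G.cost e).natDegree ≤ d) {T : Finset N} (hT : d + 1 < T.card) :
    G.dividend e T = 0 := by
  rw [dividend, ← Polynomial.coeff_zero_eq_eval_zero]
  exact iterDiff_coeff_eq_zero (jointPoly_coeff_eq_zero hd) T 0 (by omega)

theorem sum_powerset_dividend (G : CongestionGame N E) (e : E) {T U : Finset N}
    (h : Disjoint T U) : ∑ H ∈ U.powerset, G.dividend e (T ∪ H)
      = (iterDiff G.weight (G.jointPoly e) T).eval (∑ j ∈ U, G.weight j) :=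
  sum_powerset_iterDiff h

theorem jointCost_add_sub (G : CongestionGame N E) (e : E) (i : N) (x : ℝ) :
    G.jointCost e (x + G.weight i) - G.jointCost e x
      = (iterDiff G.weight (G.jointPoly e) {i}).eval x := by
  have h := iterDiff_insert (w := G.weight) (p := G.jointPoly e) (Finset.notMem_empty i)
  rw [insert_empty_eq, iterDiff_empty] at h
  rw [h, Polynomial.eval_sub, Polynomial.taylor_eval]
  simp [jointCost, jointPoly]

/-- The share of player `i` in the dividends of the coalitions within `A` that contain her. -/
noncomputable def dividendShare (G : CongestionGame N E) (e : E) (i : N) (A : Finset N) : ℝ :=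
  ∑ T ∈ A.powerset, if i ∈ T then G.dividend e T / T.card else 0

/-- All of `H` precedes `i` exactly when `i` is the last member of `insert i H`, an event of
probability `1 / |insert i H|`. -/
theorem card_preceding_mul {A H : Finset N} {i : N} (hi : i ∈ A) (hH : H ⊆ A.erase i) :
    ((Finset.univ.filter fun π : A ≃ Fin A.card =>
      H ⊆ (Finset.univ.filter fun j : A => π j < π ⟨i, hi⟩).map (Function.Embedding.subtype _)).card
        : ℝ) * ((insert i H).card : ℝ) = Fintype.card (A ≃ Fin A.card) := by
  have hiH : insert i H ⊆ A :=
    Finset.insert_subset hi (hH.trans (Finset.erase_subset _ _))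
  have hcard : ((insert i H).subtype (· ∈ A)).card = (insert i H).card := by
    rw [Finset.card_subtype, Finset.filter_true_of_mem fun x hx => hiH hx]
  have key := card_equiv_max_mul_card (n := A.card) (T := (insert i H).subtype (· ∈ A))
    (i := ⟨i, hi⟩) (by simp)
  rw [hcard] at key
  rw [← key, Nat.cast_mul]
  congr 3
  ext π
  simp only [Finset.mem_filter, Finset.mem_univ, true_and]
  constructor
  · rintro h ⟨x, hx⟩ hxT
    rw [Finset.mem_subtype, Finset.mem_insert] at hxT
    rcases hxT with rfl | hxT
    · exact le_rfl
    · obtain ⟨y, hy, hyx⟩ := Finset.mem_map.1 (h hxT)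
      have : y = ⟨x, hx⟩ := Subtype.ext hyx
      subst this
      exact (Finset.mem_filter.1 hy).2.le
  · intro h x hx
    have hxA := Finset.mem_erase.1 (hH hx)
    refine Finset.mem_map.2 ⟨⟨x, hxA.2⟩, ?_, rfl⟩
    refine Finset.mem_filter.2 ⟨Finset.mem_univ _, lt_of_le_of_ne (h ⟨x, hxA.2⟩ ?_) fun e => ?_⟩
    · simp [hx]
    · exact hxA.1 (congrArg Subtype.val (π.injective e))

/-- The marginal contribution of `i` after a set of predecessors is the sum of the dividends of
`insert i H` over the sets `H` of predecessors. Taking expectations weights each by the probability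
that `H` precedes `i`. -/
theorem shapleyShare_eq_dividendShare (G : CongestionGame N E) (e : E) (i : N) (A : Finset N) :
    G.shapleyShare e i A = G.dividendShare e i A := by
  by_cases hi : i ∈ A
  swap
  · rw [shapleyShare, dif_neg hi, dividendShare]
    refine (Finset.sum_eq_zero fun T hT => if_neg fun h => hi (Finset.mem_powerset.1 hT h)).symm
  rw [shapleyShare, dif_pos hi]
  have hcard : (0 : ℝ) < Fintype.card (A ≃ Fin A.card) := by
    have : Nonempty (A ≃ Fin A.card) := ⟨A.equivFin⟩
    exact_mod_cast Fintype.card_pos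
  have h1 : ∀ π : A ≃ Fin A.card,
      G.jointCost e (G.precedingWeight A π ⟨i, hi⟩ + G.weight i)
        - G.jointCost e (G.precedingWeight A π ⟨i, hi⟩)
      = ∑ H ∈ (A.erase i).powerset,
        if H ⊆ (Finset.univ.filter fun j : A => π j < π ⟨i, hi⟩).map (Function.Embedding.subtype _)
          then G.dividend e (insert i H) else 0 := by
    intro π
    set S := (Finset.univ.filter fun j : A => π j < π ⟨i, hi⟩).map
      (Function.Embedding.subtype (· ∈ A)) with hS
    have hw : G.precedingWeight A π ⟨i, hi⟩ = ∑ j ∈ S, G.weight j := by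
      rw [hS, Finset.sum_map]; rfl
    have hSA : S ⊆ A.erase i := by
      intro x hx
      obtain ⟨y, hy, rfl⟩ := Finset.mem_map.1 hx
      refine Finset.mem_erase.2 ⟨fun h => ?_, y.2⟩
      have : y = ⟨i, hi⟩ := Subtype.ext h
      subst this
      exact lt_irrefl _ (Finset.mem_filter.1 hy).2
    have hdisj : Disjoint {i} S := by
      rw [Finset.disjoint_singleton_left]
      exact fun h => Finset.notMem_erase i A (hSA h)
    rw [jointCost_add_sub, hw, ← G.sum_powerset_dividend e hdisj, ← Finset.sum_filter]
    refine Finset.sum_congr ?_ fun H _ => by rw [Finset.insert_eq]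
    ext H
    simp only [Finset.mem_powerset, Finset.mem_filter]
    exact ⟨fun h => ⟨h.trans hSA, h⟩, fun h => h.2⟩
  have h2 : ∀ H ∈ (A.erase i).powerset, i ∉ H := fun H hH h =>
    Finset.notMem_erase i A (Finset.mem_powerset.1 hH h)
  rw [Finset.sum_congr rfl fun π _ => h1 π, Finset.sum_comm, Finset.sum_div, dividendShare]
  conv_rhs => rw [← Finset.insert_erase hi]
  rw [Finset.sum_powerset_insert (Finset.notMem_erase i A),
    Finset.sum_eq_zero (fun H hH => if_neg (h2 H hH)), zero_add]
  refine Finset.sum_congr rfl fun H hH => ?_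
  rw [← Finset.sum_filter, Finset.sum_const, nsmul_eq_mul, if_pos (Finset.mem_insert_self i H)]
  have h3 := card_preceding_mul hi (Finset.mem_powerset.1 hH)
  have h4 : (0 : ℝ) < (insert i H).card := by
    exact_mod_cast Finset.card_pos.2 (Finset.insert_nonempty i H)
  rw [div_eq_div_iff hcard.ne' h4.ne', ← h3]
  ring

end Dividend

/-! ### Costs and partial potentials as values of classes of coalitions. -/

theorem mem_users {N E : Type*} [Fintype N] [DecidableEq E] {P : N → Finset E} {e : E} {i : N} :
    i ∈ users P e ↔ e ∈ P i := by
  simp [users]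

section Val

variable {N E : Type*} [Fintype N] [DecidableEq N] [DecidableEq E] [Fintype E]

open Classical in
/-- The total of the normalised dividends of those coalitions that share a resource in the
profile `P` and satisfy the predicate `p`. -/
noncomputable def val (G : CongestionGame N E) (P : N → Finset E) (p : Finset N → Prop) : ℝ :=
  ∑ e, ∑ T ∈ (users P e).powerset, if p T then G.dividend e T / T.card else 0

theorem val_nonneg (G : CongestionGame N E) (P : N → Finset E) (p : Finset N → Prop) :
    0 ≤ G.val P p := by
  refine Finset.sum_nonneg fun e _ => Finset.sum_nonneg fun T _ => ?_
  split_ifs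
  · exact G.term_nonneg e T
  · exact le_rfl

theorem val_mono (G : CongestionGame N E) (P : N → Finset E) {p q : Finset N → Prop}
    (h : ∀ T, p T → q T) : G.val P p ≤ G.val P q := by
  refine Finset.sum_le_sum fun e _ => Finset.sum_le_sum fun T _ => ?_
  by_cases hp : p T
  · rw [if_pos hp, if_pos (h T hp)]
  · rw [if_neg hp]
    split_ifs
    · exact G.term_nonneg e T
    · exact le_rfl

theorem val_congr_pred (G : CongestionGame N E) (P : N → Finset E) {p q : Finset N → Prop}
    (h : ∀ T, p T ↔ q T) : G.val P p = G.val P q :=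
  le_antisymm (G.val_mono P fun T => (h T).1) (G.val_mono P fun T => (h T).2)

theorem val_split (G : CongestionGame N E) (P : N → Finset E) (p q : Finset N → Prop) :
    G.val P p = G.val P (fun T => p T ∧ q T) + G.val P (fun T => p T ∧ ¬ q T) := by
  simp only [val, ← Finset.sum_add_distrib]
  refine Finset.sum_congr rfl fun e _ => Finset.sum_congr rfl fun T _ => ?_
  by_cases hp : p T <;> by_cases hq : q T <;> simp [hp, hq]

/-- `val` only depends on the strategies of the players in the coalitions under consideration. -/
theorem val_congr_profile (G : CongestionGame N E) {P P' : N → Finset E} {p : Finset N → Prop}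
    (h : ∀ T, p T → ∀ j ∈ T, P j = P' j) : G.val P p = G.val P' p := by
  classical
  refine Finset.sum_congr rfl fun e _ => ?_
  rw [← Finset.sum_filter, ← Finset.sum_filter]
  refine Finset.sum_congr ?_ fun _ _ => rfl
  ext T
  simp only [Finset.mem_filter, Finset.mem_powerset]
  refine and_congr_left fun hp => forall_congr' fun j => imp_congr_right fun hj => ?_
  rw [mem_users, mem_users, h T hp j hj]

theorem playerCost_eq_sum (G : CongestionGame N E) (P : N → Finset E) (i : N) :
    G.playerCost P i = ∑ e, G.dividendShare e i (users P e) := by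
  rw [playerCost, Finset.sum_congr rfl fun e _ => G.shapleyShare_eq_dividendShare e i _]
  refine Finset.sum_subset (Finset.subset_univ _) fun e _ he => ?_
  exact Finset.sum_eq_zero fun T hT => if_neg fun h =>
    he (mem_users.1 (Finset.mem_powerset.1 hT h))

theorem playerCost_eq_val (G : CongestionGame N E) (P : N → Finset E) (i : N) :
    G.playerCost P i = G.val P fun T => i ∈ T := by
  rw [playerCost_eq_sum, val]
  refine Finset.sum_congr rfl fun e _ => Finset.sum_congr rfl fun T _ => ?_
  congr

theorem playerCost_nonneg (G : CongestionGame N E) (P : N → Finset E) (i : N) :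
    0 ≤ G.playerCost P i := by
  rw [playerCost_eq_val]; exact G.val_nonneg P _

/-- The potential of the players in `R`. -/
noncomputable def partialPotential (G : CongestionGame N E) (R : Finset N) (P : N → Finset E) :
    ℝ :=
  G.val P fun T => ∃ j ∈ T, j ∈ R

theorem partialPotential_nonneg (G : CongestionGame N E) (R : Finset N) (P : N → Finset E) :
    0 ≤ G.partialPotential R P := G.val_nonneg P _

theorem partialPotential_le_sum (G : CongestionGame N E) (P : N → Finset E) (R : Finset N) :
    G.partialPotential R P ≤ ∑ i ∈ R, G.playerCost P i := by
  unfold partialPotential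
  induction R using Finset.induction_on with
  | empty =>
    rw [Finset.sum_empty, G.val_congr_pred P (q := fun _ => False) (by simp)]
    simp [val]
  | insert z R hz ih =>
    rw [Finset.sum_insert hz, playerCost_eq_val, G.val_split P _ fun T => z ∈ T]
    refine add_le_add (G.val_mono P fun T h => h.2) (le_trans (G.val_mono P ?_) ih)
    rintro T ⟨⟨j, hj, hjR⟩, hzT⟩
    rcases Finset.mem_insert.1 hjR with rfl | h
    · exact absurd hj hzT
    · exact ⟨j, hj, h⟩

/-- The potential is exact. -/
theorem partialPotential_sub_update (G : CongestionGame N E) (P : N → Finset E) {R : Finset N}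
    {i : N} (hi : i ∈ R) (S : Finset E) :
    G.partialPotential R P - G.partialPotential R (Function.update P i S)
      = G.playerCost P i - G.playerCost (Function.update P i S) i := by
  have key : ∀ Q : N → Finset E, G.partialPotential R Q = G.playerCost Q i
      + G.val Q (fun T => (∃ j ∈ T, j ∈ R) ∧ i ∉ T) := by
    intro Q
    rw [partialPotential, G.val_split Q _ fun T => i ∈ T, playerCost_eq_val]
    congr 1
    exact G.val_congr_pred Q fun T => ⟨fun h => h.2, fun h => ⟨⟨i, h, hi⟩, h⟩⟩
  rw [key, key, G.val_congr_profile (P := P) (P' := Function.update P i S)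
    (p := fun T => (∃ j ∈ T, j ∈ R) ∧ i ∉ T)]
  · ring
  · intro T hT j hj
    rw [Function.update_of_ne]
    rintro rfl
    exact hT.2 hj

/-- Coalitions that miss `R` have the same value in both profiles. With `R'` the set of all players,
this turns a drop of the global potential into a drop of the potential of the movers. -/
theorem partialPotential_sub_partialPotential (G : CongestionGame N E) {P Q : N → Finset E}
    {R R' : Finset N} (hR : R ⊆ R') (h : ∀ j ∉ R, P j = Q j) :
    G.partialPotential R' P - G.partialPotential R' Q
      = G.partialPotential R P - G.partialPotential R Q := by
  have key : ∀ S : N → Finset E, G.partialPotential R' S = G.partialPotential R S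
      + G.val S (fun T => (∃ j ∈ T, j ∈ R') ∧ ¬ ∃ j ∈ T, j ∈ R) := by
    intro S
    rw [partialPotential, G.val_split S _ fun T => ∃ j ∈ T, j ∈ R, partialPotential]
    congr 1
    exact G.val_congr_pred S fun T =>
      ⟨fun h => h.2, fun h => ⟨h.imp fun j hj => ⟨hj.1, hR hj.2⟩, h⟩⟩
  rw [key, key, G.val_congr_profile (P := P) (P' := Q)
    (p := fun T => (∃ j ∈ T, j ∈ R') ∧ ¬ ∃ j ∈ T, j ∈ R)]
  · ring
  · intro T hT j hj
    exact h j fun hjR => hT.2 ⟨j, hj, hjR⟩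

/-- A coalition that misses `M` may be evaluated in `Q`. This lets potentials of movers from
successive phases be added, each at its own starting profile. -/
theorem partialPotential_union (G : CongestionGame N E) {P Q : N → Finset E} {M R : Finset N}
    (h : ∀ j ∉ M, P j = Q j) :
    G.partialPotential (M ∪ R) P ≤ G.partialPotential M P + G.partialPotential R Q := by
  rw [partialPotential, G.val_split P _ fun T => ∃ j ∈ T, j ∈ M]
  refine add_le_add (G.val_mono P fun T h => h.2) ?_
  rw [G.val_congr_profile (P := P) (P' := Q)]
  · refine G.val_mono Q ?_
    rintro T ⟨⟨j, hj, hjR⟩, hT⟩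
    exact ⟨j, hj, (Finset.mem_union.1 hjR).resolve_left fun h => hT ⟨j, hj, h⟩⟩
  · intro T hT j hj
    exact h j fun hjM => hT.2 ⟨j, hj, hjM⟩

theorem playerCost_le_add_partialPotential (G : CongestionGame N E) {P Q : N → Finset E}
    {R : Finset N} (h : ∀ j ∉ R, P j = Q j) (i : N) :
    G.playerCost Q i ≤ G.playerCost P i + G.partialPotential R Q := by
  rw [playerCost_eq_val, playerCost_eq_val, add_comm, G.val_split Q _ fun T => ∃ j ∈ T, j ∈ R]
  refine add_le_add (G.val_mono Q fun T h => h.2) ?_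
  rw [G.val_congr_profile (P := Q) (P' := P)]
  · exact G.val_mono P fun T h => h.1
  · intro T hT j hj
    exact (h j fun hjM => hT.2 ⟨j, hj, hjM⟩).symm

/-- Removing the other players only deletes non-negative dividends. -/
theorem minCost_le_playerCost {G : CongestionGame N E} {P : N → Finset E} (hP : G.IsOutcome P)
    (i : N) : G.minCost ≤ G.playerCost P i := by
  have h1 : G.playerCost (Function.update (fun _ => ∅) i (P i)) i ≤ G.playerCost P i := by
    rw [playerCost_eq_sum, playerCost_eq_sum]
    refine Finset.sum_le_sum fun e _ => Finset.sum_le_sum_of_subset_of_nonneg ?_ ?_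
    · refine Finset.powerset_mono.2 fun j hj => ?_
      rw [mem_users] at hj ⊢
      by_cases hji : j = i
      · subst hji; simpa using hj
      · simp [Function.update_of_ne hji] at hj
    · intro T _ _
      split_ifs
      · exact G.term_nonneg e T
      · exact le_rfl
  refine le_trans (ciInf_le (Set.finite_range _).bddBelow i) (le_trans ?_ h1)
  exact ciInf_le (f := fun S : G.strategies i =>
    G.playerCost (Function.update (fun _ => ∅) i S) i) (Set.finite_range _).bddBelow ⟨P i, hP i⟩

end Val

end CongestionGame

/-! ### Smoothness inequalities, resource by resource and then for the game. -/

namespace CongestionGame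

theorem weight_sum_nonneg {N E : Type*} (G : CongestionGame N E) (U : Finset N) : 0 ≤ ∑ j ∈ U, G.weight j :=
  Finset.sum_nonneg fun j _ => (G.weight_pos j).le

section Smoothness

variable {N E : Type*} [DecidableEq N]

theorem sum_powerset_dividend_of_mem (G : CongestionGame N E) (e : E) {K U : Finset N}
    (h : Disjoint K U) {i : N} (hi : i ∈ U) :
    ∑ H ∈ U.powerset, (if i ∈ H then G.dividend e (K ∪ H) else 0)
      = (iterDiff G.weight (G.jointPoly e) K).eval (∑ j ∈ U, G.weight j)
        - (iterDiff G.weight (G.jointPoly e) K).eval (∑ j ∈ U.erase i, G.weight j) := by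
  have h' : Disjoint K (U.erase i) := h.mono_right (Finset.erase_subset _ _)
  have hni : ∀ H ∈ (U.erase i).powerset, i ∉ H := fun H hH h =>
    Finset.notMem_erase i U (Finset.mem_powerset.1 hH h)
  rw [← G.sum_powerset_dividend e h, ← G.sum_powerset_dividend e h']
  conv_lhs => rw [← Finset.insert_erase hi]
  conv_rhs => enter [1]; rw [← Finset.insert_erase hi]
  rw [Finset.sum_powerset_insert (Finset.notMem_erase i U),
    Finset.sum_powerset_insert (Finset.notMem_erase i U),
    Finset.sum_eq_zero (fun H hH => if_neg (hni H hH))]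
  simp

theorem sum_powerset_dividend_of_nonempty (G : CongestionGame N E) (e : E) {K U : Finset N}
    (h : Disjoint K U) :
    ∑ H ∈ U.powerset, (if H.Nonempty then G.dividend e (K ∪ H) else 0)
      = (iterDiff G.weight (G.jointPoly e) K).eval (∑ j ∈ U, G.weight j)
        - (iterDiff G.weight (G.jointPoly e) K).eval 0 := by
  rw [← G.sum_powerset_dividend e h, eq_sub_iff_add_eq]
  have : (iterDiff G.weight (G.jointPoly e) K).eval 0
      = ∑ H ∈ U.powerset, if H = ∅ then G.dividend e (K ∪ H) else 0 := by
    rw [Finset.sum_ite_eq' _ ∅ (fun H => G.dividend e (K ∪ H)),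
      if_pos (Finset.empty_mem_powerset U), Finset.union_empty]
    rfl
  rw [this, ← Finset.sum_add_distrib]
  refine Finset.sum_congr rfl fun H _ => ?_
  rcases H.eq_empty_or_nonempty with rfl | hH
  · simp
  · rw [if_pos hH, if_neg hH.ne_empty, add_zero]

/-- Split a coalition into `K ⊆ Z` and `H ⊆ U`. As `i ∈ H`, the size is at least `|K| + 1`, and with
this denominator the sum over `H` is a difference of values of the polynomial of `K`. -/
theorem dividendShare_union_le (G : CongestionGame N E) (e : E) {Z U : Finset N}
    (h : Disjoint Z U) {i : N} (hi : i ∈ U) :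
    G.dividendShare e i (Z ∪ U) ≤ ∑ K ∈ Z.powerset,
      ((iterDiff G.weight (G.jointPoly e) K).eval (∑ j ∈ U, G.weight j)
        - (iterDiff G.weight (G.jointPoly e) K).eval (∑ j ∈ U.erase i, G.weight j))
          / (K.card + 1) := by
  rw [dividendShare, sum_powerset_union h]
  refine Finset.sum_le_sum fun K hK => ?_
  have hKU : Disjoint K U := h.mono_left (Finset.mem_powerset.1 hK)
  rw [← G.sum_powerset_dividend_of_mem e hKU hi, Finset.sum_div]
  refine Finset.sum_le_sum fun H hH => ?_
  have hKH : Disjoint K H := hKU.mono_right (Finset.mem_powerset.1 hH)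
  have hiK : i ∉ K := fun hiK => (Finset.disjoint_left.1 hKU hiK) hi
  by_cases hiH : i ∈ H
  · rw [if_pos (Finset.mem_union_right _ hiH), if_pos hiH]
    refine div_le_div_of_nonneg_left (G.dividend_nonneg e _) (by positivity) ?_
    have : 1 ≤ H.card := Finset.card_pos.2 ⟨i, hiH⟩
    rw [Finset.card_union_of_disjoint hKH]
    exact_mod_cast Nat.add_le_add_left this _
  · rw [if_neg (by simp [hiK, hiH]), if_neg hiH, zero_div]

/-- The players in a non-empty `H` together receive the fraction `|H| / (|K| + |H|)` of the dividend
of `K ∪ H`, which is at least `1 / (|K| + 1)`. -/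
theorem le_sum_dividendShare (G : CongestionGame N E) (e : E) {Z U : Finset N}
    (h : Disjoint Z U) :
    ∑ K ∈ Z.powerset, ((iterDiff G.weight (G.jointPoly e) K).eval (∑ j ∈ U, G.weight j)
        - (iterDiff G.weight (G.jointPoly e) K).eval 0) / (K.card + 1)
      ≤ ∑ i ∈ U, G.dividendShare e i (Z ∪ U) := by
  simp only [dividendShare]
  rw [Finset.sum_congr rfl fun i _ => sum_powerset_union h _, Finset.sum_comm]
  refine Finset.sum_le_sum fun K hK => ?_
  have hKU : Disjoint K U := h.mono_left (Finset.mem_powerset.1 hK)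
  rw [← G.sum_powerset_dividend_of_nonempty e hKU, Finset.sum_div, Finset.sum_comm]
  refine Finset.sum_le_sum fun H hH => ?_
  have hHU : H ⊆ U := Finset.mem_powerset.1 hH
  have hKH : Disjoint K H := hKU.mono_right hHU
  have hiff : ∀ i ∈ U, (if i ∈ K ∪ H then G.dividend e (K ∪ H) / (K ∪ H).card else 0)
      = if i ∈ H then G.dividend e (K ∪ H) / (K ∪ H).card else 0 := by
    intro i hi
    have hiK : i ∉ K := fun hiK => (Finset.disjoint_left.1 hKU hiK) hi
    simp [hiK]
  rw [Finset.sum_congr rfl hiff, ← Finset.sum_filter, Finset.sum_const, nsmul_eq_mul,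
    Finset.filter_mem_eq_inter, Finset.inter_eq_right.2 hHU,
    Finset.card_union_of_disjoint hKH]
  split_ifs with hne
  · have h1 : (1 : ℝ) ≤ H.card := by exact_mod_cast Finset.card_pos.2 hne
    have h2 := G.dividend_nonneg e (K ∪ H)
    have h3 : (0 : ℝ) ≤ K.card := Nat.cast_nonneg _
    rw [← mul_div_assoc, div_le_div_iff₀ (by positivity) (by push_cast; linarith)]
    push_cast
    nlinarith [mul_nonneg h2 (mul_nonneg h3 (sub_nonneg.2 h1))]
  · rw [zero_div]
    exact mul_nonneg (Nat.cast_nonneg _) (div_nonneg (G.dividend_nonneg e _) (Nat.cast_nonneg _))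

/-- The potential counts only the fraction `1 / |K ∪ H|`; only coalitions of size at most `d + 1`
have a dividend, so the factor `d + 1` makes up for the difference. -/
theorem le_mul_sum_term (G : CongestionGame N E) {e : E} {d : ℕ}
    (hd : (G.cost e).natDegree ≤ d) {Z U R : Finset N} (h : Disjoint Z U) (hU : U ⊆ R) :
    ∑ K ∈ Z.powerset, ((iterDiff G.weight (G.jointPoly e) K).eval (∑ j ∈ U, G.weight j)
        - (iterDiff G.weight (G.jointPoly e) K).eval 0) / (K.card + 1)
      ≤ (d + 1) * ∑ T ∈ (Z ∪ U).powerset,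
        if ∃ j ∈ T, j ∈ R then G.dividend e T / T.card else 0 := by
  rw [sum_powerset_union h, Finset.mul_sum]
  refine Finset.sum_le_sum fun K hK => ?_
  have hKU : Disjoint K U := h.mono_left (Finset.mem_powerset.1 hK)
  rw [← G.sum_powerset_dividend_of_nonempty e hKU, Finset.sum_div, Finset.mul_sum]
  refine Finset.sum_le_sum fun H hH => ?_
  have hHU : H ⊆ U := Finset.mem_powerset.1 hH
  have hKH : Disjoint K H := hKU.mono_right hHU
  by_cases hne : H.Nonempty
  · obtain ⟨j, hj⟩ := hne
    rw [if_pos ⟨j, hj⟩, if_pos ⟨j, Finset.mem_union_right _ hj, hU (hHU hj)⟩]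
    by_cases hc : d + 1 < (K ∪ H).card
    · rw [dividend_eq_zero hd hc]; simp
    · have h2 := G.dividend_nonneg e (K ∪ H)
      have h3 : (0 : ℝ) ≤ K.card := Nat.cast_nonneg _
      have h4 : ((K ∪ H).card : ℝ) ≤ d + 1 := by exact_mod_cast not_lt.1 hc
      have h5 : (0 : ℝ) < (K ∪ H).card := by
        exact_mod_cast Finset.card_pos.2 ⟨j, Finset.mem_union_right _ hj⟩
      rw [← mul_div_assoc, div_le_div_iff₀ (by positivity) h5]
      have h6 : ((K ∪ H).card : ℝ) ≤ (d + 1) * (K.card + 1) := by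
        nlinarith [mul_nonneg (h5.le.trans h4) h3]
      nlinarith [mul_le_mul_of_nonneg_left h6 h2]
  · rw [if_neg hne, zero_div]
    split_ifs
    · exact mul_nonneg (by positivity) (G.term_nonneg e _)
    · simp

theorem iterDiff_jointPoly_eval_add_sub_le {G : CongestionGame N E} {e : E} {d : ℕ}
    (hd : (G.cost e).natDegree ≤ d) (K : Finset N) {l a b : ℝ} (hl : 0 < l) (ha : 0 ≤ a)
    (hb : 0 ≤ b) :
    (iterDiff G.weight (G.jointPoly e) K).eval (a + b)
        - (iterDiff G.weight (G.jointPoly e) K).eval 0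
      ≤ (1 + l) ^ d * ((iterDiff G.weight (G.jointPoly e) K).eval a
          - (iterDiff G.weight (G.jointPoly e) K).eval 0)
        + ((1 + l) / l) ^ d * ((iterDiff G.weight (G.jointPoly e) K).eval b
          - (iterDiff G.weight (G.jointPoly e) K).eval 0) :=
  Polynomial.eval_add_sub_le (G.iterDiff_jointPoly_coeff_nonneg e K)
    (fun k hk => iterDiff_coeff_eq_zero (jointPoly_coeff_eq_zero hd) K k (by omega)) hl ha hb

/-- The local smoothness inequality behind the bound on the stretch. -/
theorem sum_dividendShare_insert_le (G : CongestionGame N E) {e : E} {d : ℕ}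
    (hd : (G.cost e).natDegree ≤ d) {A B D : Finset N} (hAB : A \ D = B \ D) {l : ℝ}
    (hl : 0 < l) :
    ∑ i ∈ B ∩ D, G.dividendShare e i (insert i A)
      ≤ ((1 + l) ^ d - 1) * ∑ i ∈ D, G.dividendShare e i A
        + (d + 1) * ((1 + l) / l) ^ d * ∑ T ∈ B.powerset,
          if ∃ j ∈ T, j ∈ D then G.dividend e T / T.card else 0 := by
  have hc : ∀ K : Finset N, (0 : ℝ) ≤ K.card + 1 := fun K => by positivity
  set Z := A \ D with hZ
  set Q := fun K => iterDiff G.weight (G.jointPoly e) K with hQ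
  set a := ∑ j ∈ A ∩ D, G.weight j with ha
  set b := ∑ j ∈ B ∩ D, G.weight j with hb
  have ha0 : 0 ≤ a := G.weight_sum_nonneg _
  have hb0 : 0 ≤ b := G.weight_sum_nonneg _
  have hZD : ∀ U : Finset N, U ⊆ D → Disjoint Z U := fun U hU =>
    Finset.disjoint_of_subset_right hU Finset.sdiff_disjoint
  have hA : A = Z ∪ (A ∩ D) := by rw [hZ, Finset.sdiff_union_inter]
  have hB : B = Z ∪ (B ∩ D) := by rw [hAB, Finset.sdiff_union_inter]
  have hnn : ∀ K, ∀ k, 0 ≤ (Q K).coeff k := G.iterDiff_jointPoly_coeff_nonneg e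
  have h1 : ∑ i ∈ B ∩ D, G.dividendShare e i (insert i A)
      ≤ ∑ K ∈ Z.powerset, ((Q K).eval (a + b) - (Q K).eval a) / (K.card + 1) := by
    have : ∀ i ∈ B ∩ D, G.dividendShare e i (insert i A)
        ≤ ∑ K ∈ Z.powerset, ((Q K).eval (a + G.weight i) - (Q K).eval a) / (K.card + 1) := by
      intro i hi
      have hiD : i ∈ D := (Finset.mem_inter.1 hi).2
      have e1 : insert i A = Z ∪ insert i (A ∩ D) := by
        rw [Finset.union_insert, ← hA]
      rw [e1]
      refine (G.dividendShare_union_le e (hZD _ (Finset.insert_subset hiD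
        Finset.inter_subset_right)) (Finset.mem_insert_self _ _)).trans ?_
      refine Finset.sum_le_sum fun K _ => div_le_div_of_nonneg_right ?_ (hc K)
      -- If `i` already uses the resource, her share involves the increment that ends at `a`;
      -- increasing differences replace it by the one that starts at `a`.
      by_cases hiA : i ∈ A ∩ D
      · have e2 : a = ∑ j ∈ (A ∩ D).erase i, G.weight j + G.weight i :=
          (Finset.sum_erase_add _ _ hiA).symm
        rw [Finset.insert_eq_of_mem hiA, ← ha]
        have := Polynomial.eval_add_sub_mono (hnn K)
          (G.weight_sum_nonneg ((A ∩ D).erase i)) (y := a) (by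
            rw [e2]; linarith [G.weight_pos i]) (G.weight_pos i).le
        rw [← e2] at this
        exact this
      · rw [Finset.sum_insert hiA, Finset.erase_insert hiA, ← ha, add_comm (G.weight i)]
    refine (Finset.sum_le_sum this).trans ?_
    rw [Finset.sum_comm]
    refine Finset.sum_le_sum fun K _ => ?_
    rw [← Finset.sum_div]
    exact div_le_div_of_nonneg_right (Polynomial.sum_eval_add_sub_le (hnn K) ha0
      (fun i => (G.weight_pos i).le) _) (hc K)
  have h2 : ∑ K ∈ Z.powerset, ((Q K).eval a - (Q K).eval 0) / (K.card + 1)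
      ≤ ∑ i ∈ D, G.dividendShare e i A := by
    have := G.le_sum_dividendShare e (hZD _ (Finset.inter_subset_right (s₁ := A)))
    rw [← hA] at this
    refine this.trans (Finset.sum_le_sum_of_subset_of_nonneg Finset.inter_subset_right ?_)
    intro i _ _
    refine Finset.sum_nonneg fun T _ => ?_
    split_ifs
    · exact G.term_nonneg e T
    · exact le_rfl
  have h3 := G.le_mul_sum_term hd (hZD _ (Finset.inter_subset_right (s₁ := B)))
    Finset.inter_subset_right
  rw [← hB] at h3
  have hl1 : (1 : ℝ) ≤ (1 + l) ^ d := one_le_pow₀ (by linarith)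
  have hl2 : (0 : ℝ) ≤ ((1 + l) / l) ^ d := by positivity
  have h4 := mul_le_mul_of_nonneg_left h2 (sub_nonneg.2 hl1)
  have h5 := mul_le_mul_of_nonneg_left h3 hl2
  rw [mul_comm ((d : ℝ) + 1), mul_assoc]
  refine h1.trans (le_trans ?_ (add_le_add h4 h5))
  rw [Finset.mul_sum, Finset.mul_sum, ← Finset.sum_add_distrib]
  refine Finset.sum_le_sum fun K _ => ?_
  rw [← mul_div_assoc, ← mul_div_assoc, ← add_div]
  refine div_le_div_of_nonneg_right ?_ (hc K)
  -- The increment starts at `a` rather than `0`; subtracting the value gained up to `a` turns `(1 +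
  -- l)^d` into `(1 + l)^d - 1`.
  have := iterDiff_jointPoly_eval_add_sub_le hd K hl ha0 hb0
  simp only [hQ]
  linarith

/-- The weight `w_i + v`, with `v` the weight of the users in `R`, is split by the weighted
inequality: the part of `w_i` is the share of `i` without `R`, and the part of `v` is covered by the
potential of `R`. -/
theorem dividendShare_insert_le (G : CongestionGame N E) {e : E} {d : ℕ}
    (hd : (G.cost e).natDegree ≤ d) {A R : Finset N} {i : N} (hi : i ∉ R) {l : ℝ} (hl : 0 < l) :
    G.dividendShare e i (insert i A)
      ≤ (1 + l) ^ d * G.dividendShare e i (insert i (A \ R))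
        + (d + 1) * ((1 + l) / l) ^ d * ∑ T ∈ A.powerset,
          if ∃ j ∈ T, j ∈ R then G.dividend e T / T.card else 0 := by
  have hc : ∀ K : Finset N, (0 : ℝ) ≤ K.card + 1 := fun K => by positivity
  set Z := (A \ R).erase i with hZ
  set Q := fun K => iterDiff G.weight (G.jointPoly e) K with hQ
  set v := ∑ j ∈ A ∩ R, G.weight j with hv
  have hv0 : 0 ≤ v := G.weight_sum_nonneg _
  have hiV : i ∉ A ∩ R := fun h => hi (Finset.mem_inter.1 h).2
  have hZV : Disjoint Z (A ∩ R) := by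
    rw [Finset.disjoint_left]
    intro x hx hx'
    simp only [hZ, Finset.mem_erase, Finset.mem_sdiff, Finset.mem_inter] at hx hx'
    exact hx.2.2 hx'.2
  have hZi : i ∉ Z := Finset.notMem_erase _ _
  have e1 : insert i A = Z ∪ insert i (A ∩ R) := by
    ext x
    simp only [hZ, Finset.mem_insert, Finset.mem_union, Finset.mem_erase, Finset.mem_sdiff,
      Finset.mem_inter]
    tauto
  have e2 : insert i (A \ R) = Z ∪ {i} := by
    ext x
    simp only [hZ, Finset.mem_insert, Finset.mem_union, Finset.mem_erase, Finset.mem_sdiff,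
      Finset.mem_singleton]
    tauto
  have hnn : ∀ K, ∀ k, 0 ≤ (Q K).coeff k := G.iterDiff_jointPoly_coeff_nonneg e
  have h1 : G.dividendShare e i (insert i A) ≤ ∑ K ∈ Z.powerset,
      ((Q K).eval (G.weight i + v) - (Q K).eval 0) / (K.card + 1) := by
    rw [e1]
    refine (G.dividendShare_union_le e (Finset.disjoint_insert_right.2 ⟨hZi, hZV⟩)
      (Finset.mem_insert_self _ _)).trans ?_
    refine Finset.sum_le_sum fun K _ => div_le_div_of_nonneg_right ?_ (hc K)
    rw [Finset.sum_insert hiV, Finset.erase_insert hiV, ← hv]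
    have := Polynomial.coeff_zero_le_eval (hnn K) hv0
    rw [Polynomial.coeff_zero_eq_eval_zero] at this
    exact sub_le_sub_left this _
  have h2 := G.le_sum_dividendShare e (Z := Z) (U := {i})
    (Finset.disjoint_singleton_right.2 hZi)
  rw [Finset.sum_singleton, Finset.sum_singleton, ← e2] at h2
  have h3 := G.le_mul_sum_term hd hZV Finset.inter_subset_right
  have h3' : ∑ T ∈ (Z ∪ A ∩ R).powerset, (if ∃ j ∈ T, j ∈ R then G.dividend e T / T.card else 0)
      ≤ ∑ T ∈ A.powerset, if ∃ j ∈ T, j ∈ R then G.dividend e T / T.card else 0 := by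
    refine Finset.sum_le_sum_of_subset_of_nonneg (Finset.powerset_mono.2 ?_) fun T _ _ => ?_
    · refine Finset.union_subset ?_ Finset.inter_subset_left
      exact (Finset.erase_subset _ _).trans Finset.sdiff_subset
    · split_ifs
      · exact G.term_nonneg e T
      · exact le_rfl
  have hl1 : (0 : ℝ) ≤ (1 + l) ^ d := by positivity
  have hl2 : (0 : ℝ) ≤ ((1 + l) / l) ^ d := by positivity
  have h4 := mul_le_mul_of_nonneg_left h2 hl1
  have h5 := mul_le_mul_of_nonneg_left
    (h3.trans (mul_le_mul_of_nonneg_left h3' (by positivity))) hl2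
  rw [mul_comm ((d : ℝ) + 1), mul_assoc]
  refine h1.trans (le_trans ?_ (add_le_add h4 h5))
  rw [Finset.mul_sum, Finset.mul_sum, ← Finset.sum_add_distrib]
  refine Finset.sum_le_sum fun K _ => ?_
  rw [← mul_div_assoc, ← mul_div_assoc, ← add_div]
  refine div_le_div_of_nonneg_right ?_ (hc K)
  exact iterDiff_jointPoly_eval_add_sub_le hd K hl (G.weight_pos i).le hv0

theorem dividendShare_mono (G : CongestionGame N E) (e : E) (i : N) {A B : Finset N}
    (h : A ⊆ B) : G.dividendShare e i A ≤ G.dividendShare e i B := by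
  refine Finset.sum_le_sum_of_subset_of_nonneg (Finset.powerset_mono.2 h) fun T _ _ => ?_
  split_ifs
  · exact G.term_nonneg e T
  · exact le_rfl

end Smoothness

section Stretch

variable {N E : Type*} [Fintype N] [DecidableEq N] [DecidableEq E]

theorem playerCost_update_eq_sum (G : CongestionGame N E) (P : N → Finset E) (i : N)
    (S : Finset E) : G.playerCost (Function.update P i S) i
      = ∑ e ∈ S, G.dividendShare e i (insert i (users P e)) := by
  rw [playerCost, Function.update_self]
  refine Finset.sum_congr rfl fun e he => ?_
  rw [shapleyShare_eq_dividendShare]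
  congr 1
  ext j
  rw [Finset.mem_insert, mem_users, mem_users]
  rcases eq_or_ne j i with rfl | hj
  · simpa using he
  · simp [hj]

variable [Fintype E]

/-- Smoothness of the game restricted to the players in `D`. -/
theorem sum_playerCost_update_le (G : CongestionGame N E) {d : ℕ}
    (hd : ∀ e, (G.cost e).natDegree ≤ d) {P Q : N → Finset E} {D : Finset N}
    (h : ∀ j ∉ D, P j = Q j) {l : ℝ} (hl : 0 < l) :
    ∑ i ∈ D, G.playerCost (Function.update P i (Q i)) i
      ≤ ((1 + l) ^ d - 1) * ∑ i ∈ D, G.playerCost P i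
        + (d + 1) * ((1 + l) / l) ^ d * G.partialPotential D Q := by
  have h1 : ∑ i ∈ D, G.playerCost (Function.update P i (Q i)) i
      = ∑ e, ∑ i ∈ users Q e ∩ D, G.dividendShare e i (insert i (users P e)) := by
    simp only [playerCost_update_eq_sum]
    refine Finset.sum_comm' fun i e => ?_
    simp only [Finset.mem_univ, and_true, Finset.mem_inter, mem_users]
    exact and_comm
  have h2 : ∑ i ∈ D, G.playerCost P i = ∑ e, ∑ i ∈ D, G.dividendShare e i (users P e) := by
    simp only [playerCost_eq_sum]
    exact Finset.sum_comm
  rw [h1, h2, partialPotential, val, Finset.mul_sum, Finset.mul_sum, ← Finset.sum_add_distrib]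
  refine Finset.sum_le_sum fun e _ => ?_
  have hPQ : users P e \ D = users Q e \ D := by
    ext j
    simp only [Finset.mem_sdiff, mem_users]
    exact and_congr_left fun hj => by rw [h j hj]
  refine (G.sum_dividendShare_insert_le (hd e) hPQ hl).trans (le_of_eq ?_)
  congr 2
  exact Finset.sum_congr rfl fun T _ => by congr

/-- The cost of an alternative strategy of a player outside `R` cannot drop much when the players
in `R`, whose partial potential is small, deviate. -/
theorem playerCost_update_le_add (G : CongestionGame N E) {d : ℕ}
    (hd : ∀ e, (G.cost e).natDegree ≤ d) {P Q : N → Finset E} {R : Finset N}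
    (h : ∀ j ∉ R, P j = Q j) {i : N} (hi : i ∉ R) {l : ℝ} (hl : 0 < l) (S : Finset E) :
    G.playerCost (Function.update P i S) i
      ≤ (1 + l) ^ d * G.playerCost (Function.update Q i S) i
        + (d + 1) * ((1 + l) / l) ^ d * G.partialPotential R P := by
  classical
  rw [playerCost_update_eq_sum, playerCost_update_eq_sum]
  have h1 : ∑ e ∈ S, ∑ T ∈ (users P e).powerset,
      (if ∃ j ∈ T, j ∈ R then G.dividend e T / T.card else 0) ≤ G.partialPotential R P := by
    have : ∀ e : E, 0 ≤ ∑ T ∈ (users P e).powerset,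
      (if ∃ j ∈ T, j ∈ R then G.dividend e T / T.card else 0) := fun e =>
      Finset.sum_nonneg fun T _ => by
        split_ifs
        · exact G.term_nonneg e T
        · exact le_rfl
    refine (Finset.sum_le_sum_of_subset_of_nonneg (Finset.subset_univ S)
      fun e _ _ => this e).trans (le_of_eq ?_)
    exact Finset.sum_congr rfl fun e _ => Finset.sum_congr rfl fun T _ => by congr
  have hΛ : (0 : ℝ) ≤ (d + 1) * ((1 + l) / l) ^ d := by positivity
  refine le_trans ?_ (add_le_add le_rfl (mul_le_mul_of_nonneg_left h1 hΛ))
  rw [Finset.mul_sum, Finset.mul_sum, ← Finset.sum_add_distrib]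
  refine Finset.sum_le_sum fun e _ => (G.dividendShare_insert_le (hd e) hi hl).trans ?_
  refine add_le_add (mul_le_mul_of_nonneg_left (G.dividendShare_mono e i
    (Finset.insert_subset_insert i ?_)) (by positivity)) le_rfl
  intro j hj
  rw [Finset.mem_sdiff] at hj
  rw [mem_users, ← h j hj.2, ← mem_users]
  exact hj.1

end Stretch

end CongestionGame

/-! ### Estimates for the numerical constants. -/

/-- The number `2^{1/(d+1)} - 1`. -/
noncomputable def rootGap (d : ℕ) : ℝ := (2 : ℝ) ^ (1 / ((d : ℝ) + 1)) - 1

theorem one_add_rootGap_pow (d : ℕ) : (1 + rootGap d) ^ (d + 1) = 2 := by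
  rw [rootGap, add_sub_cancel, ← Real.rpow_natCast, ← Real.rpow_mul (by norm_num)]
  push_cast
  rw [one_div_mul_cancel (by positivity), Real.rpow_one]

theorem log_two_div_le_rootGap (d : ℕ) : Real.log 2 / (d + 1) ≤ rootGap d := by
  rw [rootGap, Real.rpow_def_of_pos (by norm_num)]
  have := Real.add_one_le_exp (Real.log 2 * (1 / ((d : ℝ) + 1)))
  rw [mul_one_div] at this ⊢
  linarith

theorem rootGap_pos (d : ℕ) : 0 < rootGap d :=
  lt_of_lt_of_le (div_pos (Real.log_pos (by norm_num)) (by positivity)) (log_two_div_le_rootGap d)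

theorem rootGap_le_one (d : ℕ) : rootGap d ≤ 1 := by
  have h := one_add_rootGap_pow d
  have := le_self_pow₀ (M₀ := ℝ) (a := 1 + rootGap d) (by linarith [rootGap_pos d])
    (Nat.succ_ne_zero d)
  rw [Nat.succ_eq_add_one, h] at this
  linarith

/-- The number `2^{-d/(d+1)} (1 + t) - t`. -/
noncomputable def stretchDenom (d : ℕ) (t : ℝ) : ℝ := ((1 + rootGap d) ^ d)⁻¹ * (1 + t) - t

theorem stretchBound_eq (d : ℕ) (t : ℝ) : stretchBound d t =
    ((d : ℝ) + 1) ^ 2 * ((d : ℝ) + 3) / 8 * (t * (rootGap d ^ d)⁻¹ / stretchDenom d t) := by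
  have : (2 : ℝ) ^ (-(d : ℝ) / ((d : ℝ) + 1)) = ((1 + rootGap d) ^ d)⁻¹ := by
    rw [rootGap, add_sub_cancel, ← Real.rpow_natCast, ← Real.rpow_mul (by norm_num),
      ← Real.rpow_neg (by norm_num)]
    congr 1
    ring
  rw [stretchBound, stretchDenom, this, rootGap]

theorem stretchDenom_pos {d : ℕ} {t : ℝ} (ht : 0 < t) (h : 0 < stretchBound d t) :
    0 < stretchDenom d t := by
  rw [stretchBound_eq] at h
  have h1 := pos_of_mul_pos_right h (by positivity)
  have h2 : 0 < t * (rootGap d ^ d)⁻¹ := by have := rootGap_pos d; positivity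
  exact (div_pos_iff_of_pos_left h2).1 h1

/-- The coefficient of the optimum in the smoothness inequality. -/
noncomputable def smoothCoeff (d : ℕ) : ℝ := (d + 1) * ((1 + rootGap d) / rootGap d) ^ d

theorem two_le_smoothCoeff {d : ℕ} (hd : 1 ≤ d) : 2 ≤ smoothCoeff d := by
  have h1 : (1 : ℝ) ≤ ((1 + rootGap d) / rootGap d) ^ d :=
    one_le_pow₀ ((one_le_div (rootGap_pos d)).2 (by linarith))
  have h2 : (1 : ℝ) ≤ d := by exact_mod_cast hd
  rw [smoothCoeff]
  nlinarith

theorem one_le_one_add_rootGap_pow (d : ℕ) : 1 ≤ (1 + rootGap d) ^ d :=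
  one_le_pow₀ (by linarith [rootGap_pos d])

theorem one_add_rootGap_pow_le_two (d : ℕ) : (1 + rootGap d) ^ d ≤ 2 := by
  rw [← one_add_rootGap_pow d]
  exact pow_le_pow_right₀ (by linarith [rootGap_pos d]) (Nat.le_succ d)

section StretchBound

variable {d : ℕ} {t : ℝ}

theorem smooth_gap_eq : (1 + rootGap d) ^ d * stretchDenom d t
    = 1 + t - t * (1 + rootGap d) ^ d := by
  have : (1 + rootGap d) ^ d ≠ 0 := by linarith [one_le_one_add_rootGap_pow d]
  rw [stretchDenom]
  field_simp

/-- After cancelling the denominator, what remains is `d + 1 ≤ (d+1)²(d+3)/8`, an equality at `d =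
1`. -/
theorem mul_smoothCoeff_le (hd : 1 ≤ d) (ht : 0 < t) (h : 0 < stretchBound d t) :
    t * smoothCoeff d ≤ stretchBound d t * (1 + t - t * (1 + rootGap d) ^ d) := by
  have hden := stretchDenom_pos ht h
  have hl := rootGap_pos d
  have hc : 0 < 1 + rootGap d := by linarith
  have h1 : (1 : ℝ) ≤ d := by exact_mod_cast hd
  rw [← smooth_gap_eq, stretchBound_eq]
  have : ((d : ℝ) + 1) ^ 2 * ((d : ℝ) + 3) / 8 * (t * (rootGap d ^ d)⁻¹ / stretchDenom d t)
      * ((1 + rootGap d) ^ d * stretchDenom d t)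
      = ((d : ℝ) + 1) ^ 2 * ((d : ℝ) + 3) / 8 * (t * ((1 + rootGap d) / rootGap d) ^ d) := by
    rw [div_pow]
    field_simp
  rw [this, smoothCoeff, mul_left_comm]
  refine mul_le_mul_of_nonneg_right ?_ (by positivity)
  nlinarith

theorem mul_smoothCoeff_le_stretchBound (hd : 1 ≤ d) (ht : 0 < t) (h : 0 < stretchBound d t) :
    t * smoothCoeff d ≤ stretchBound d t := by
  refine (mul_smoothCoeff_le hd ht h).trans (mul_le_of_le_one_right h.le ?_)
  nlinarith [one_le_one_add_rootGap_pow d]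

/-- The danger is a denominator `δ` of `Θ` close to `0`. But `Θδ ≥ 1` turns `γ ≤ 1/(4Θ)` into `γ ≤
δ/4`, which keeps `δ` at least half of `l = rootGap d`. Hence `Θ` is of order `(d+1)²(d+3)
l^{-(d+1)}`, and `1/l ≤ (d+1)/ln 2`. -/
theorem stretchBound_le {γ : ℝ} (hd : 1 ≤ d) (hγ : 0 < γ) (h : 0 < stretchBound d (1 + γ))
    (hγ4 : γ ≤ 1 / (4 * stretchBound d (1 + γ))) :
    16 * stretchBound d (1 + γ)
      ≤ ((d : ℝ) / Real.log 2) ^ d * (48 * ((d : ℝ) + 1) ^ 3 * ((d : ℝ) + 3)) := by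
  have ht : 0 < 1 + γ := by linarith
  have hden := stretchDenom_pos ht h
  have hl := rootGap_pos d
  have hl1 := rootGap_le_one d
  have h1 : (1 : ℝ) ≤ d := by exact_mod_cast hd
  have hlog : 0 < Real.log 2 := Real.log_pos (by norm_num)
  have hΘ1 : 1 ≤ stretchBound d (1 + γ) := by
    have := mul_smoothCoeff_le_stretchBound hd ht h
    nlinarith [two_le_smoothCoeff hd]
  have hγ1 : γ ≤ 1 := hγ4.trans (by rw [div_le_one (by positivity)]; linarith)
  set Θ := stretchBound d (1 + γ) with hΘ
  set δ := stretchDenom d (1 + γ) with hδ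
  set K : ℝ := ((d : ℝ) + 1) ^ 2 * ((d : ℝ) + 3) / 8 with hK
  have hK1 : 1 ≤ K := by rw [hK]; nlinarith
  have hΘδ : Θ * δ = K * ((1 + γ) * (rootGap d ^ d)⁻¹) := by
    rw [hΘ, stretchBound_eq, ← hδ, ← hK]; field_simp
  have hinv : 1 ≤ (rootGap d ^ d)⁻¹ := (one_le_inv₀ (by positivity)).2 (pow_le_one₀ hl.le hl1)
  have hge : 1 ≤ Θ * δ := by
    rw [hΘδ]
    have : 1 ≤ (1 + γ) * (rootGap d ^ d)⁻¹ := by nlinarith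
    nlinarith
  have hγδ : γ ≤ δ / 4 := by
    refine hγ4.trans ?_
    rw [div_le_div_iff₀ (by positivity) (by norm_num)]
    linarith
  have hδl : rootGap d / 2 ≤ δ := by
    have hcd : ((1 + rootGap d) ^ d)⁻¹ = (1 + rootGap d) / 2 := by
      rw [← one_add_rootGap_pow d, pow_succ]
      have : 1 + rootGap d ≠ 0 := by linarith
      field_simp
    -- Here `(1 + l)^{d+1} = 2` has replaced `(1 + l)^{-d}` by `(1 + l)/2`.
    have : δ = rootGap d - γ * (1 - (1 + rootGap d) / 2) := by
      rw [hδ, stretchDenom, hcd]; ring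
    nlinarith
  have hΘle : Θ ≤ 4 * K * (rootGap d)⁻¹ ^ (d + 1) := by
    have e1 : Θ = K * ((1 + γ) * (rootGap d ^ d)⁻¹) / δ := by rw [← hΘδ]; field_simp
    rw [e1, div_le_iff₀ hden]
    have e2 : 4 * K * (rootGap d)⁻¹ ^ (d + 1) * (rootGap d / 2)
        = K * (2 * (rootGap d ^ d)⁻¹) := by
      rw [pow_succ, inv_pow]; field_simp; norm_num
    calc K * ((1 + γ) * (rootGap d ^ d)⁻¹) ≤ K * (2 * (rootGap d ^ d)⁻¹) := by
          gcongr; linarith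
      _ = _ := e2.symm
      _ ≤ _ := by gcongr
  have hlinv : (rootGap d)⁻¹ ≤ ((d : ℝ) + 1) / Real.log 2 := by
    rw [← inv_div]
    exact inv_anti₀ (by positivity) (log_two_div_le_rootGap d)
  have hexp : ((d : ℝ) + 1) ^ d ≤ 3 * (d : ℝ) ^ d := by
    have e1 : (d : ℝ) + 1 = d * (1 / d + 1) := by field_simp; ring
    rw [e1, mul_pow, mul_comm]
    refine mul_le_mul_of_nonneg_right ?_ (by positivity)
    calc ((1 : ℝ) / d + 1) ^ d ≤ Real.exp (1 / d) ^ d := by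
          gcongr; exact Real.add_one_le_exp _
      _ = Real.exp 1 := by
          rw [← Real.exp_nat_mul]; congr 1; field_simp
      _ ≤ 3 := by linarith [Real.exp_one_lt_d9]
  have hlog2 : 1 / Real.log 2 ≤ 2 := by
    rw [div_le_iff₀ hlog]; linarith [Real.log_two_gt_d9]
  have hpow : (rootGap d)⁻¹ ^ (d + 1) ≤ ((d : ℝ) / Real.log 2) ^ d * (6 * ((d : ℝ) + 1)) := by
    calc (rootGap d)⁻¹ ^ (d + 1) ≤ (((d : ℝ) + 1) / Real.log 2) ^ (d + 1) := by gcongr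
      _ = ((d : ℝ) + 1) ^ d / Real.log 2 ^ d * (((d : ℝ) + 1) * (1 / Real.log 2)) := by
          rw [pow_succ, div_pow]; ring
      _ ≤ 3 * (d : ℝ) ^ d / Real.log 2 ^ d * (((d : ℝ) + 1) * 2) := by gcongr
      _ = _ := by rw [div_pow]; ring
  calc 16 * Θ ≤ 16 * (4 * K * (((d : ℝ) / Real.log 2) ^ d * (6 * ((d : ℝ) + 1)))) := by
        gcongr
        exact hΘle.trans (by gcongr)
    _ = _ := by rw [hK]; ring

end StretchBound

/-! ### Stretch of approximate equilibria and potential of the movers. -/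

namespace CongestionGame

variable {N E : Type*} [Fintype N] [DecidableEq N] [DecidableEq E] [Fintype E]

/-- The bound on the stretch of the partial potentials of approximate equilibria. -/
theorem partialPotential_le_stretchBound_mul (G : CongestionGame N E) {d : ℕ} (hd1 : 1 ≤ d)
    (hd : ∀ e, (G.cost e).natDegree ≤ d) {t β : ℝ} (ht : 1 ≤ t) (hβ : 0 ≤ β)
    (hΘ : 0 < stretchBound d t) {P Q : N → Finset E} {D : Finset N} (h : ∀ j ∉ D, P j = Q j)
    (heq : ∀ i ∈ D, G.playerCost P i ≤ t * G.playerCost (Function.update P i (Q i)) i + β) :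
    G.partialPotential D P
      ≤ stretchBound d t * (G.partialPotential D Q + D.card * β) := by
  have ht0 : 0 < t := by linarith
  have h1 := G.sum_playerCost_update_le hd h (rootGap_pos d)
  have h2 : ∑ i ∈ D, G.playerCost P i
      ≤ t * ∑ i ∈ D, G.playerCost (Function.update P i (Q i)) i + D.card * β := by
    refine (Finset.sum_le_sum heq).trans (le_of_eq ?_)
    rw [Finset.sum_add_distrib, Finset.mul_sum, Finset.sum_const, nsmul_eq_mul]
  refine (G.partialPotential_le_sum P D).trans ?_
  set X := ∑ i ∈ D, G.playerCost P i
  set W := 1 + t - t * (1 + rootGap d) ^ d with hW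
  have hWpos : 0 < W := by
    rw [hW, ← smooth_gap_eq]
    exact mul_pos (by linarith [one_le_one_add_rootGap_pow d]) (stretchDenom_pos ht0 hΘ)
  have h3 := mul_smoothCoeff_le hd1 ht0 hΘ
  have h4 : 1 ≤ t * smoothCoeff d := by nlinarith [two_le_smoothCoeff hd1]
  have hΦ := G.partialPotential_nonneg D Q
  have hβ' : 0 ≤ D.card * β := mul_nonneg (Nat.cast_nonneg _) hβ
  -- Smoothness bounds the deviation costs partly by `X` itself; `W` is what remains of `X` once
  -- that part is moved to the left.
  have h5 : W * X ≤ t * smoothCoeff d * G.partialPotential D Q + D.card * β := by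
    have := mul_le_mul_of_nonneg_left h1 ht0.le
    rw [smoothCoeff]
    nlinarith
  have h6 := mul_le_mul_of_nonneg_right h3 hΦ
  have h7 := mul_le_mul_of_nonneg_right (h4.trans h3) hβ'
  refine le_of_mul_le_mul_left ?_ hWpos
  linarith

/-- `R` is a set of players that contains all those who moved on the way from `Q` to `P`, where
every move either was an `s`-move or led to a cost of at most `b`. -/
structure MoveHistory (G : CongestionGame N E) (s b : ℝ) (Q P : N → Finset E) (R : Finset N) :
    Prop where
  agree : ∀ j ∉ R, Q j = P j
  bound : ∀ R' ⊆ R, G.val P (fun T => (∃ j ∈ T, j ∈ R') ∧ ∀ j ∈ T, j ∈ R → j ∈ R')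
    ≤ (G.partialPotential Finset.univ Q - G.partialPotential Finset.univ P) / (s - 1) + R'.card * b

theorem MoveHistory.refl (G : CongestionGame N E) (s b : ℝ) (P : N → Finset E) :
    G.MoveHistory s b P P ∅ := by
  refine ⟨fun _ _ => rfl, fun R' hR' => ?_⟩
  rw [Finset.subset_empty.1 hR', G.val_congr_pred P (q := fun _ => False) (by simp)]
  simp [val]

/-- Each coalition is charged to its last mover, whose cost after that move contains its value. A
player may move again, and then her old charge must be discarded: this is why the bound ranges over
`R' ⊆ R` and over coalitions whose movers all lie in `R'`, so that the induction hypothesis applies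
to `R'.erase i`. -/
theorem MoveHistory.step {G : CongestionGame N E} {s b : ℝ} (hs : 1 < s) (hb : 0 ≤ b)
    {Q P : N → Finset E} {R : Finset N} (h : G.MoveHistory s b Q P R) {i : N} {S : Finset E}
    (hle : G.playerCost (Function.update P i S) i ≤ G.playerCost P i)
    (hmove : s * G.playerCost (Function.update P i S) i ≤ G.playerCost P i ∨
      G.playerCost (Function.update P i S) i ≤ b) :
    G.MoveHistory s b Q (Function.update P i S) (insert i R) := by
  have hs1 : 0 < s - 1 := by linarith
  set P' := Function.update P i S with hP'
  have hpot := G.partialPotential_sub_update P (Finset.mem_univ i) S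
  rw [← hP'] at hpot
  have hcongr : ∀ R' : Finset N, i ∉ R' →
      G.val P' (fun T => (∃ j ∈ T, j ∈ R') ∧ ∀ j ∈ T, j ∈ insert i R → j ∈ R')
      ≤ G.val P (fun T => (∃ j ∈ T, j ∈ R') ∧ ∀ j ∈ T, j ∈ R → j ∈ R') := by
    intro R' hi
    rw [G.val_congr_profile (P := P') (P' := P)]
    · exact G.val_mono P fun T hT =>
        ⟨hT.1, fun j hj hjR => hT.2 j hj (Finset.mem_insert_of_mem hjR)⟩
    · intro T hT j hj
      rw [hP', Function.update_of_ne]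
      rintro rfl
      exact hi (hT.2 j hj (Finset.mem_insert_self _ _))
  refine ⟨fun j hj => ?_, fun R' hR' => ?_⟩
  · rw [Finset.mem_insert, not_or] at hj
    rw [hP', Function.update_of_ne hj.1]
    exact h.agree j hj.2
  · by_cases hi : i ∈ R'
    · have hsub : R'.erase i ⊆ R := fun j hj =>
        (Finset.mem_insert.1 (hR' (Finset.mem_of_mem_erase hj))).resolve_left
          (Finset.ne_of_mem_erase hj)
      have h1 := (hcongr _ (Finset.notMem_erase i R')).trans (h.bound _ hsub)
      have h2 : G.val P' (fun T => (∃ j ∈ T, j ∈ R') ∧ ∀ j ∈ T, j ∈ insert i R → j ∈ R')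
          ≤ G.playerCost P' i + G.val P'
            (fun T => (∃ j ∈ T, j ∈ R'.erase i) ∧ ∀ j ∈ T, j ∈ insert i R → j ∈ R'.erase i) := by
        rw [G.val_split P' _ fun T => i ∈ T, playerCost_eq_val]
        refine add_le_add (G.val_mono P' fun T hT => hT.2) (G.val_mono P' ?_)
        rintro T ⟨⟨⟨j, hj, hjR⟩, hT⟩, hiT⟩
        have hne : ∀ k ∈ T, k ≠ i := fun k hk e => hiT (e ▸ hk)
        exact ⟨⟨j, hj, Finset.mem_erase.2 ⟨hne j hj, hjR⟩⟩,
          fun k hk hkR => Finset.mem_erase.2 ⟨hne k hk, hT k hk hkR⟩⟩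
      have h3 : ((R'.erase i).card : ℝ) = R'.card - 1 := by
        rw [eq_sub_iff_add_eq]
        exact_mod_cast Finset.card_erase_add_one hi
      rw [h3] at h1
      -- After an `s`-move the new cost is at most the gain divided by `s - 1`; otherwise it is at
      -- most `b`.
      have h4 : G.playerCost P' i
          ≤ (G.partialPotential Finset.univ P - G.partialPotential Finset.univ P') / (s - 1)
            + b := by
        rw [hpot]
        rcases hmove with hm | hm
        · have : G.playerCost P' i ≤ (G.playerCost P i - G.playerCost P' i) / (s - 1) := by
            rw [le_div_iff₀ hs1]; linarith
          linarith
        · have : 0 ≤ (G.playerCost P i - G.playerCost P' i) / (s - 1) :=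
            div_nonneg (by linarith) hs1.le
          linarith
      have h5 : (G.partialPotential Finset.univ Q - G.partialPotential Finset.univ P) / (s - 1)
          + (G.partialPotential Finset.univ P - G.partialPotential Finset.univ P') / (s - 1)
          = (G.partialPotential Finset.univ Q - G.partialPotential Finset.univ P') / (s - 1) := by
        ring
      linarith
    · have hsub : R' ⊆ R := fun j hj =>
        (Finset.mem_insert.1 (hR' hj)).resolve_left fun e => hi (e ▸ hj)
      refine (hcongr R' hi).trans ((h.bound R' hsub).trans ?_)
      gcongr
      linarith

theorem MoveHistory.partialPotential_le {G : CongestionGame N E} {s b : ℝ}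
    {Q P : N → Finset E} {R : Finset N} (h : G.MoveHistory s b Q P R) :
    G.partialPotential R P
      ≤ (G.partialPotential R Q - G.partialPotential R P) / (s - 1) + R.card * b := by
  have h1 := h.bound R subset_rfl
  rw [G.partialPotential_sub_partialPotential (Finset.subset_univ R) h.agree] at h1
  refine le_trans (le_of_eq ?_) h1
  exact G.val_congr_pred P fun T => ⟨fun hT => ⟨hT, fun j _ hj => hj⟩, fun hT => hT.1⟩

/-- At the start of a phase the partial potential of the players who move in it is small. -/
theorem MoveHistory.partialPotential_start_le {G : CongestionGame N E} {d : ℕ} (hd1 : 1 ≤ d)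
    (hd : ∀ e, (G.cost e).natDegree ≤ d) {γ s b : ℝ} (hγ : 0 < γ) (hb : 0 ≤ b)
    (hΘ : 0 < stretchBound d (1 + γ)) (hs : 1 < s)
    (hsΘ : s⁻¹ = 1 / stretchBound d (1 + γ) - 2 * γ)
    {Q P : N → Finset E} {R : Finset N} (h : G.MoveHistory s b Q P R)
    (heq : ∀ i ∈ R, G.playerCost Q i ≤ (1 + γ) * G.playerCost (Function.update Q i (P i)) i + b) :
    G.partialPotential R Q ≤ R.card * b / γ := by
  have h1 := G.partialPotential_le_stretchBound_mul hd1 hd (by linarith) hb hΘ h.agree heq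
  have h2 := h.partialPotential_le
  set Θ := stretchBound d (1 + γ)
  set x := G.partialPotential R Q
  set y := G.partialPotential R P
  set B : ℝ := R.card * b with hB
  have hB0 : 0 ≤ B := mul_nonneg (Nat.cast_nonneg _) hb
  have hs1 : 0 < s - 1 := by linarith
  have hs0 : 0 < s := by linarith
  have h3 : y ≤ x * s⁻¹ + B := by
    rw [← sub_le_iff_le_add, le_div_iff₀ hs1] at h2
    rw [← sub_le_iff_le_add, ← div_eq_mul_inv, le_div_iff₀ hs0]
    nlinarith
  -- Together with the stretch bound `x ≤ Θ(y + B)` this leaves `2γΘx ≤ 2ΘB`; the term `2γ` in `1/s`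
  -- is the margin that makes it work.
  have h4 : Θ * y ≤ x * (1 - 2 * γ * Θ) + Θ * B := by
    have := mul_le_mul_of_nonneg_left h3 hΘ.le
    rw [hsΘ] at this
    have e : Θ * (x * (1 / Θ - 2 * γ) + B) = x * (1 - 2 * γ * Θ) + Θ * B := by
      field_simp
    linarith
  rw [le_div_iff₀ hγ]
  refine le_of_mul_le_mul_left ?_ (show 0 < 2 * Θ by linarith)
  linarith

end CongestionGame

namespace CongestionGame

theorem IsOutcome.update {N E : Type*} [DecidableEq N] {G : CongestionGame N E} {P : N → Finset E} (h : G.IsOutcome P) {i : N}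
    {S : Finset E} (hS : S ∈ G.strategies i) : G.IsOutcome (Function.update P i S) := by
  intro j
  rcases eq_or_ne j i with rfl | hj
  · rwa [Function.update_self]
  · rw [Function.update_of_ne hj]; exact h j

variable {N E : Type*} [Fintype N] [DecidableEq N] [DecidableEq E]

theorem playerCost_le_maxCost (G : CongestionGame N E) (P : N → Finset E) (i : N) :
    G.playerCost P i ≤ G.maxCost P :=
  le_ciSup (f := fun i => G.playerCost P i) (Set.finite_range _).bddAbove i

theorem exists_isBestResponse (G : CongestionGame N E) (P : N → Finset E) (i : N) :
    ∃ S, G.IsBestResponse P i S :=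
  (G.strategies i).exists_min_image (fun S => G.playerCost (Function.update P i S) i)
    (G.strategies_nonempty i)

theorem IsBestResponse.mul_lt {G : CongestionGame N E} {P : N → Finset E} {i : N} {S : Finset E}
    (h : G.IsBestResponse P i S) {ρ : ℝ} (hρ : 0 ≤ ρ) (hm : G.HasMove ρ P i) :
    ρ * G.playerCost (Function.update P i S) i < G.playerCost P i := by
  obtain ⟨S', hS', hlt⟩ := hm
  exact (mul_le_mul_of_nonneg_left (h.2 S' hS') hρ).trans_lt hlt

theorem partialPotential_univ_le [Fintype E] (G : CongestionGame N E) (P : N → Finset E) :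
    G.partialPotential Finset.univ P ≤ Fintype.card N * G.maxCost P := by
  refine (G.partialPotential_le_sum P Finset.univ).trans ?_
  refine (Finset.sum_le_sum fun i _ => G.playerCost_le_maxCost P i).trans (le_of_eq ?_)
  rw [Finset.sum_const, nsmul_eq_mul, Finset.card_univ]

end CongestionGame

/-! ### Parameters and block borders of the algorithm. -/

namespace PhasedBestResponse

open CongestionGame

variable {N E : Type*} [Fintype N] [DecidableEq N] [DecidableEq E]

/-- The assumptions on the input of the algorithm. -/
structure Admissible (G : CongestionGame N E) (d : ℕ) (γ : ℝ) (P₀ : N → Finset E) : Prop where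
  one_le_deg : 1 ≤ d
  natDegree_le : ∀ e, (G.cost e).natDegree ≤ d
  outcome : G.IsOutcome P₀
  minCost_pos : 0 < G.minCost
  pos : 0 < γ
  stretch_pos : 0 < stretchBound d (1 + γ)
  lt : γ < 1 / (2 * stretchBound d (1 + γ))

/-- A bound on the number of improvement steps in a phase `r ≥ 1`. -/
noncomputable def phaseSteps (n d : ℕ) (γ : ℝ) : ℝ := n * blockRatio n d γ * (1 + γ) / γ ^ 2

/-- A bound on the number of improvement steps in the initial phase. -/
noncomputable def initialSteps (n d : ℕ) (γ : ℝ) : ℝ := n * blockRatio n d γ * (1 + γ) / γ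

theorem sFactor_inv (d : ℕ) (γ : ℝ) :
    (sFactor d γ)⁻¹ = 1 / stretchBound d (1 + γ) - 2 * γ := by
  rw [sFactor, tFactor, inv_inv]

namespace Admissible

section

variable {G : CongestionGame N E} {d : ℕ} {γ : ℝ} {P₀ : N → Finset E} (h : Admissible G d γ P₀)

include h

theorem two_mul_le_stretchBound : 2 * (1 + γ) ≤ stretchBound d (1 + γ) := by
  have hγ := h.pos
  have := mul_smoothCoeff_le_stretchBound h.one_le_deg (by linarith) h.stretch_pos
  nlinarith [two_le_smoothCoeff h.one_le_deg]

theorem lt_quarter : γ < 1 / 4 := by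
  have hγ := h.pos
  have := h.two_mul_le_stretchBound
  refine h.lt.trans_le (one_div_le_one_div_of_le (by norm_num) (by linarith))

theorem sFactor_inv_pos : 0 < 1 / stretchBound d (1 + γ) - 2 * γ := by
  have := h.lt
  have hΘ := h.stretch_pos
  rw [lt_div_iff₀ (by positivity)] at this
  rw [sub_pos, lt_div_iff₀ hΘ]
  linarith

theorem stretchBound_le_sFactor : stretchBound d (1 + γ) ≤ sFactor d γ := by
  rw [sFactor, tFactor, ← one_div, le_one_div h.stretch_pos h.sFactor_inv_pos]
  linarith [h.pos]

theorem tFactor_le_sFactor : 1 + γ ≤ sFactor d γ := by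
  have := h.pos
  linarith [h.two_mul_le_stretchBound, h.stretchBound_le_sFactor]

theorem one_lt_sFactor : 1 < sFactor d γ := by
  linarith [h.pos, h.tFactor_le_sFactor]

variable [Nonempty N]

theorem blockRatio_ge : 4 ≤ blockRatio (Fintype.card N) d γ := by
  have hn : (1 : ℝ) ≤ Fintype.card N := by exact_mod_cast Fintype.card_pos (α := N)
  have hd : (1 : ℝ) ≤ d := by exact_mod_cast h.one_le_deg
  have hγ := h.pos
  have hγ1 := h.lt_quarter
  have h3 : 1 ≤ (γ ^ 3)⁻¹ :=
    (one_le_inv₀ (by positivity)).2 (pow_le_one₀ hγ.le (by linarith))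
  have h4 : 4 ≤ 2 * (Fintype.card N : ℝ) * ((d : ℝ) + 1) := by nlinarith
  rw [blockRatio]
  nlinarith

theorem blockRatio_pos : 0 < blockRatio (Fintype.card N) d γ := by
  linarith [h.blockRatio_ge]

theorem border_succ (r : ℕ) :
    border G d γ P₀ (r + 1) * blockRatio (Fintype.card N) d γ = border G d γ P₀ r := by
  have := h.blockRatio_pos
  rw [border, border, pow_succ]
  field_simp

variable [Fintype E]

theorem minCost_le_maxCost : G.minCost ≤ G.maxCost P₀ := by
  obtain ⟨i⟩ := ‹Nonempty N›
  exact (minCost_le_playerCost h.outcome i).trans (G.playerCost_le_maxCost P₀ i)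

theorem maxCost_pos : 0 < G.maxCost P₀ := h.minCost_pos.trans_le h.minCost_le_maxCost

theorem border_pos (r : ℕ) : 0 < border G d γ P₀ r :=
  mul_pos h.maxCost_pos (inv_pos.2 (pow_pos h.blockRatio_pos r))

theorem border_succ_le (r : ℕ) : border G d γ P₀ (r + 1) * 2 ≤ border G d γ P₀ r := by
  rw [← h.border_succ r]
  exact mul_le_mul_of_nonneg_left (by linarith [h.blockRatio_ge]) (h.border_pos _).le

/-- The number of blocks is a natural logarithm, and the block ratio is at least `4 > e`. -/
theorem border_le_minCost {r : ℕ} (hr : numBlocks G P₀ ≤ r) :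
    border G d γ P₀ r ≤ G.minCost := by
  have hg := h.blockRatio_ge
  have h1 : Real.log (G.maxCost P₀ / G.minCost) ≤ r :=
    (Nat.le_ceil _).trans (by exact_mod_cast hr)
  have h2 : G.maxCost P₀ / G.minCost ≤ blockRatio (Fintype.card N) d γ ^ r := by
    rw [← Real.exp_log (div_pos h.maxCost_pos h.minCost_pos)]
    calc _ ≤ Real.exp r := Real.exp_le_exp.2 h1
      _ = Real.exp 1 ^ r := by rw [← Real.exp_nat_mul, mul_one]
      _ ≤ _ := by
          gcongr
          linarith [Real.exp_one_lt_d9]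
  rw [div_le_iff₀ h.minCost_pos] at h2
  rw [border, ← div_eq_mul_inv, div_le_iff₀ (pow_pos h.blockRatio_pos r)]
  linarith

theorem numBlocks_le : (numBlocks G P₀ : ℝ) ≤ Real.log (G.maxCost P₀ / G.minCost) + 1 :=
  (Nat.ceil_lt_add_one (Real.log_nonneg
    ((one_le_div h.minCost_pos).2 h.minCost_le_maxCost))).le

end

end Admissible

/-! ### Invariants of the execution and the number of steps. -/

/-- The invariant of the initial phase. -/
structure InitialInv [Fintype E] (G : CongestionGame N E) (d : ℕ) (γ : ℝ) (P₀ : N → Finset E)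
    (c : Config N E) : Prop where
  phase : c.phase = 0
  finished : c.finished = ∅
  outcome : G.IsOutcome c.state
  steps : c.steps * (γ / (1 + γ) * border G d γ P₀ 1) + G.partialPotential Finset.univ c.state
    ≤ G.partialPotential Finset.univ P₀

/-- The invariant of a player `i` that is finished when phase `r` starts in the state `Q`: she
became finished at the end of a phase `k < r` in a state `S`, and those who moved since then had
small partial potential. -/
def FinishedInv [Fintype E] (G : CongestionGame N E) (d : ℕ) (γ : ℝ) (P₀ : N → Finset E)
    (r : ℕ) (Q : N → Finset E) (i : N) : Prop :=
  ∃ (k : ℕ) (S : N → Finset E) (M : Finset N), i ∉ M ∧ (∀ j ∉ M, S j = Q j) ∧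
    border G d γ P₀ k ≤ G.playerCost S i ∧ ¬ G.HasMove (sFactor d γ) S i ∧
    G.playerCost Q i ≤ G.playerCost S i
      + 2 * Fintype.card N / γ * (border G d γ P₀ (k + 1) - border G d γ P₀ r) ∧
    G.partialPotential M S
      ≤ 2 * Fintype.card N / γ * (border G d γ P₀ (k + 1) - border G d γ P₀ r)

/-- The invariant of a phase `r ≥ 1` that started in the state `Q` after `k` improvement steps and
in which at most the players in `R` have moved. -/
structure PhaseInv [Fintype E] (G : CongestionGame N E) (d : ℕ) (γ : ℝ) (P₀ : N → Finset E)
    (c : Config N E) (Q : N → Finset E) (R : Finset N) (k : ℕ) : Prop where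
  one_le : 1 ≤ c.phase
  le : c.phase ≤ numBlocks G P₀ - 1 + 1
  outcome : G.IsOutcome c.state
  unfinished : ∀ i ∈ R, i ∉ c.finished
  history : G.MoveHistory (sFactor d γ) (border G d γ P₀ c.phase) Q c.state R
  start : ∀ i, i ∉ c.finished → border G d γ P₀ c.phase ≤ G.playerCost Q i →
    ¬ G.HasMove (1 + γ) Q i
  steps : ((c.steps : ℝ) - k) * (γ / (1 + γ) * border G d γ P₀ (c.phase + 1))
    + G.partialPotential Finset.univ c.state ≤ G.partialPotential Finset.univ Q
  start_steps : (k : ℝ) ≤ initialSteps (Fintype.card N) d γ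
    + (c.phase - 1) * phaseSteps (Fintype.card N) d γ
  finished : ∀ i ∈ c.finished, FinishedInv G d γ P₀ c.phase Q i
  halted : Halted G P₀ c → R = ∅

theorem improvement_lower_bound {t x y b γ : ℝ} (hγ : 0 < γ) (ht : 1 + γ ≤ t) (hy : 0 ≤ y)
    (h : t * y < x) (hb : b ≤ x) : γ / (1 + γ) * b ≤ x - y := by
  rw [div_mul_eq_mul_div, div_le_iff₀ (by linarith)]
  nlinarith

section Invariants

variable {G : CongestionGame N E} {d : ℕ} {γ : ℝ} {P₀ : N → Finset E} {c : Config N E}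

theorem halted_of_no_step (hc : ∀ c', ¬ Step G d γ P₀ c c') : Halted G P₀ c := by
  by_contra hh
  by_cases hel : ∃ i, Eligible G d γ P₀ c i
  · obtain ⟨i, hi⟩ := hel
    obtain ⟨S, hS⟩ := G.exists_isBestResponse c.state i
    exact hc _ (Step.improve c i S hh hi hS)
  · exact hc _ (Step.nextPhase c hh (not_exists.1 hel))

variable [Fintype E]

/-- The invariant of the algorithm. -/
def Inv (G : CongestionGame N E) (d : ℕ) (γ : ℝ) (P₀ : N → Finset E) (c : Config N E) : Prop :=
  InitialInv G d γ P₀ c ∨ ∃ Q R, ∃ k : ℕ, (k : ℝ) ≤ c.steps ∧ PhaseInv G d γ P₀ c Q R k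

theorem inv_initial (h : Admissible G d γ P₀) : Inv G d γ P₀ (initial P₀) := by
  refine Or.inl ⟨rfl, rfl, h.outcome, ?_⟩
  simp [initial]

theorem InitialInv.improve (h : Admissible G d γ P₀) (hc : InitialInv G d γ P₀ c) {i : N}
    {S : Finset E} (eligible : Eligible G d γ P₀ c i) (best : G.IsBestResponse c.state i S) :
    InitialInv G d γ P₀ ⟨c.phase, Function.update c.state i S, c.finished, c.steps + 1⟩ := by
  refine ⟨hc.phase, hc.finished, hc.outcome.update best.1, ?_⟩
  have hγ := h.pos
  rcases eligible with ⟨-, hb, hm⟩ | ⟨h1, -⟩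
  · have h1 := best.mul_lt (by rw [tFactor]; linarith) hm
    have h2 := improvement_lower_bound hγ le_rfl (G.playerCost_nonneg _ i) h1 hb
    have h3 := G.partialPotential_sub_update c.state (Finset.mem_univ i) S
    have h4 := hc.steps
    push_cast
    linarith
  · rw [hc.phase] at h1
    omega

theorem Inv.phase_le (hc : Inv G d γ P₀ c) : c.phase ≤ numBlocks G P₀ - 1 + 1 := by
  rcases hc with hc | ⟨Q, R, k, -, hc⟩
  · rw [hc.phase]; omega
  · exact hc.le

variable [Nonempty N]

/-- The movers of phase `r` add at most `n b_r / γ` to each error. Since `b_{r+1} ≤ b_r / 2`, this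
is at most `(2n/γ)(b_r - b_{r+1})`, so the errors telescope. -/
theorem FinishedInv.extend (h : Admissible G d γ P₀) {r : ℕ} {Q P : N → Finset E} {i : N}
    (hi : FinishedInv G d γ P₀ r Q i) {R : Finset N} (hiR : i ∉ R) (hR : ∀ j ∉ R, Q j = P j)
    (hQ : G.partialPotential R Q ≤ Fintype.card N * border G d γ P₀ r / γ)
    (hPQ : G.partialPotential R P ≤ G.partialPotential R Q) :
    FinishedInv G d γ P₀ (r + 1) P i := by
  obtain ⟨k, S, M, hiM, hSQ, hk, hm, hc, hp⟩ := hi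
  have hγ := h.pos
  have key : Fintype.card N * border G d γ P₀ r / γ
      ≤ 2 * Fintype.card N / γ * (border G d γ P₀ r - border G d γ P₀ (r + 1)) := by
    have h1 := h.border_succ_le r
    have h2 : (0 : ℝ) ≤ Fintype.card N / γ := by positivity
    have := mul_le_mul_of_nonneg_left
      (show border G d γ P₀ r ≤ 2 * (border G d γ P₀ r - border G d γ P₀ (r + 1)) by linarith) h2
    calc _ = Fintype.card N / γ * border G d γ P₀ r := by ring
      _ ≤ _ := this
      _ = _ := by ring
  have hsum : 2 * Fintype.card N / γ * (border G d γ P₀ (k + 1) - border G d γ P₀ r)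
      + 2 * Fintype.card N / γ * (border G d γ P₀ r - border G d γ P₀ (r + 1))
      = 2 * Fintype.card N / γ * (border G d γ P₀ (k + 1) - border G d γ P₀ (r + 1)) := by ring
  refine ⟨k, S, M ∪ R, by simp [hiM, hiR], fun j hj => ?_, hk, hm, ?_, ?_⟩
  · rw [Finset.mem_union, not_or] at hj
    rw [hSQ j hj.1, hR j hj.2]
  · have := G.playerCost_le_add_partialPotential hR i
    linarith
  · have := G.partialPotential_union hSQ (R := R)
    linarith

theorem FinishedInv.of_no_move {r : ℕ} {P : N → Finset E} {i : N}
    (hc : border G d γ P₀ r ≤ G.playerCost P i) (hm : ¬ G.HasMove (sFactor d γ) P i) :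
    FinishedInv G d γ P₀ (r + 1) P i := by
  refine ⟨r, P, ∅, by simp, fun _ _ => rfl, hc, hm, by simp, ?_⟩
  rw [partialPotential, G.val_congr_pred P (q := fun _ => False) (by simp)]
  simp [val]

/-- The potential starts at no more than `n X_max = n g b_1`, and every step lowers it by at least
`γ/(1+γ)·b_1`. -/
theorem InitialInv.steps_le (h : Admissible G d γ P₀) (hc : InitialInv G d γ P₀ c) :
    (c.steps : ℝ) ≤ initialSteps (Fintype.card N) d γ := by
  have hγ := h.pos
  have h1 := hc.steps
  have h2 := G.partialPotential_nonneg Finset.univ c.state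
  have h3 := G.partialPotential_univ_le P₀
  have hb := h.border_succ 0
  have hb1 := h.border_pos 1
  have h0 : border G d γ P₀ 0 = G.maxCost P₀ := by simp [border]
  rw [← h0, ← hb] at h3
  rw [initialSteps, le_div_iff₀ hγ]
  have h4 : (c.steps : ℝ) * (γ / (1 + γ) * border G d γ P₀ 1)
      ≤ Fintype.card N * (border G d γ P₀ 1 * blockRatio (Fintype.card N) d γ) := by linarith
  have h5 : (c.steps : ℝ) * γ * border G d γ P₀ 1
      ≤ Fintype.card N * blockRatio (Fintype.card N) d γ * (1 + γ) * border G d γ P₀ 1 := by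
    have := mul_le_mul_of_nonneg_right h4 (show (0 : ℝ) ≤ 1 + γ by linarith)
    have e : (c.steps : ℝ) * (γ / (1 + γ) * border G d γ P₀ 1) * (1 + γ)
      = c.steps * γ * border G d γ P₀ 1 := by field_simp
    rw [e] at this
    linarith
  exact le_of_mul_le_mul_right h5 hb1

namespace PhaseInv

variable {Q : N → Finset E} {R : Finset N} {k : ℕ}

theorem start_potential_le (h : Admissible G d γ P₀) (hc : PhaseInv G d γ P₀ c Q R k) :
    G.partialPotential R Q ≤ Fintype.card N * border G d γ P₀ c.phase / γ := by
  have hγ := h.pos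
  have hb := (h.border_pos c.phase).le
  have h1 := hc.history.partialPotential_start_le h.one_le_deg h.natDegree_le hγ hb
    h.stretch_pos h.one_lt_sFactor (sFactor_inv d γ) ?_
  · refine h1.trans ?_
    gcongr
    exact Finset.card_le_univ R
  · intro i hi
    have hnn := G.playerCost_nonneg (Function.update Q i (c.state i)) i
    by_cases hcost : border G d γ P₀ c.phase ≤ G.playerCost Q i
    · have := hc.start i (hc.unfinished i hi) hcost
      have := not_lt.1 fun hlt => this ⟨c.state i, hc.outcome i, hlt⟩
      linarith
    -- A starting cost below `b_r` is covered by the additive slack alone.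
    · nlinarith

theorem end_potential_le (h : Admissible G d γ P₀) (hc : PhaseInv G d γ P₀ c Q R k)
    (hk : (k : ℝ) ≤ c.steps) : G.partialPotential R c.state ≤ G.partialPotential R Q := by
  have h1 := hc.steps
  have h2 := G.partialPotential_sub_partialPotential (Finset.subset_univ R) hc.history.agree
  have hγ := h.pos
  have h3 : 0 ≤ ((c.steps : ℝ) - k) * (γ / (1 + γ) * border G d γ P₀ (c.phase + 1)) :=
    mul_nonneg (by linarith) (mul_nonneg (by positivity) (h.border_pos _).le)
  linarith

/-- Only the potential of the movers can be used up during the phase. It starts at no more than `n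
b_r/γ = n g b_{r+1}/γ`, which is `phaseSteps` times the guaranteed gain per step. -/
theorem steps_le (h : Admissible G d γ P₀) (hc : PhaseInv G d γ P₀ c Q R k) :
    (c.steps : ℝ) ≤ initialSteps (Fintype.card N) d γ
      + c.phase * phaseSteps (Fintype.card N) d γ := by
  have hγ := h.pos
  have h1 := hc.steps
  have h2 := G.partialPotential_sub_partialPotential (Finset.subset_univ R) hc.history.agree
  have h3 := hc.start_potential_le h
  have h4 := G.partialPotential_nonneg R c.state
  have hb := h.border_succ c.phase
  have hb1 := h.border_pos (c.phase + 1)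
  have h5 : ((c.steps : ℝ) - k) * (γ / (1 + γ) * border G d γ P₀ (c.phase + 1))
      ≤ Fintype.card N * (border G d γ P₀ (c.phase + 1) * blockRatio (Fintype.card N) d γ) / γ := by
    rw [hb]; linarith
  have h6 : ((c.steps : ℝ) - k) ≤ phaseSteps (Fintype.card N) d γ := by
    have e : phaseSteps (Fintype.card N) d γ * (γ / (1 + γ) * border G d γ P₀ (c.phase + 1))
        = Fintype.card N * (border G d γ P₀ (c.phase + 1) * blockRatio (Fintype.card N) d γ)
          / γ := by
      rw [phaseSteps]
      field_simp
    rw [← e] at h5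
    exact le_of_mul_le_mul_right h5 (mul_pos (by positivity) hb1)
  linarith [hc.start_steps]

end PhaseInv

theorem InitialInv.nextPhase (h : Admissible G d γ P₀) (hc : InitialInv G d γ P₀ c)
    (none_eligible : ∀ i, ¬ Eligible G d γ P₀ c i) :
    PhaseInv G d γ P₀ ⟨c.phase + 1, c.state, finishedAfter G d γ P₀ c, c.steps⟩ c.state ∅
      c.steps where
  one_le := Nat.succ_pos _
  le := by simp [hc.phase]
  outcome := hc.outcome
  unfinished := by simp
  history := MoveHistory.refl G _ _ _
  start := by
    intro i _ hb hm
    refine none_eligible i (Or.inl ⟨hc.phase, ?_, hm⟩)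
    simpa [hc.phase] using hb
  steps := by simp
  start_steps := by simpa [hc.phase] using hc.steps_le h
  finished := by simp [finishedAfter, hc.phase, hc.finished]
  halted _ := rfl

theorem PhaseInv.improve (h : Admissible G d γ P₀) {Q : N → Finset E} {R : Finset N} {k : ℕ}
    (hc : PhaseInv G d γ P₀ c Q R k) (running : ¬ Halted G P₀ c) {i : N} {S : Finset E}
    (eligible : Eligible G d γ P₀ c i) (best : G.IsBestResponse c.state i S) :
    PhaseInv G d γ P₀ ⟨c.phase, Function.update c.state i S, c.finished, c.steps + 1⟩ Q
      (insert i R) k := by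
  have hγ := h.pos
  have hs := h.one_lt_sFactor
  have hts := h.tFactor_le_sFactor
  have hnn := G.playerCost_nonneg (Function.update c.state i S) i
  have hpos := h.border_pos (c.phase + 1)
  have hbb := h.border_succ_le c.phase
  obtain ⟨h1, hif, hel⟩ := eligible.resolve_left fun h0 => by
    have := hc.one_le
    omega
  have key : G.playerCost (Function.update c.state i S) i ≤ G.playerCost c.state i ∧
      γ / (1 + γ) * border G d γ P₀ (c.phase + 1)
        ≤ G.playerCost c.state i - G.playerCost (Function.update c.state i S) i ∧
      (sFactor d γ * G.playerCost (Function.update c.state i S) i ≤ G.playerCost c.state i ∨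
        G.playerCost (Function.update c.state i S) i ≤ border G d γ P₀ c.phase) := by
    rcases hel with ⟨hb, hm⟩ | ⟨hb, hb', hm⟩
    · have h2 := best.mul_lt (by linarith) hm
      have h3 := improvement_lower_bound hγ hts hnn h2
        (show border G d γ P₀ (c.phase + 1) ≤ _ by linarith)
      exact ⟨by nlinarith, h3, Or.inl h2.le⟩
    · have h2 := best.mul_lt (by rw [tFactor]; linarith) hm
      rw [tFactor] at h2
      have h3 := improvement_lower_bound hγ le_rfl hnn h2 hb
      exact ⟨by nlinarith, h3, Or.inr (by nlinarith)⟩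
  refine ⟨hc.one_le, hc.le, hc.outcome.update best.1, ?_, ?_, hc.start, ?_, hc.start_steps,
    hc.finished, fun hh => absurd hh running⟩
  · intro j hj
    rcases Finset.mem_insert.1 hj with rfl | hj
    · exact hif
    · exact hc.unfinished j hj
  · exact hc.history.step hs (h.border_pos _).le key.1 key.2.2
  · have h3 := G.partialPotential_sub_update c.state (Finset.mem_univ i) S
    have h4 := hc.steps
    push_cast
    linarith [key.2.1]

theorem PhaseInv.nextPhase (h : Admissible G d γ P₀) {Q : N → Finset E} {R : Finset N} {k : ℕ}
    (hc : PhaseInv G d γ P₀ c Q R k) (hk : (k : ℝ) ≤ c.steps) (running : ¬ Halted G P₀ c)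
    (none_eligible : ∀ i, ¬ Eligible G d γ P₀ c i) :
    PhaseInv G d γ P₀ ⟨c.phase + 1, c.state, finishedAfter G d γ P₀ c, c.steps⟩ c.state ∅
      c.steps := by
  have hne : c.phase ≠ 0 := by have := hc.one_le; omega
  have hfin : ∀ i, i ∈ finishedAfter G d γ P₀ c ↔
      i ∈ c.finished ∨ border G d γ P₀ c.phase ≤ G.playerCost c.state i := by
    intro i
    rw [finishedAfter, if_neg hne]
    simp
  refine ⟨Nat.succ_pos _, ?_, hc.outcome, by simp, MoveHistory.refl G _ _ _, ?_, by simp, ?_, ?_,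
    fun _ => rfl⟩
  · exact Nat.succ_le_succ (not_lt.1 running)
  · intro i hi hb hm
    -- A player still unfinished costs less than `b_r`, so with cost at least `b_{r+1}` she lies in
    -- the block where `t`-moves were allowed.
    rw [hfin, not_or, not_le] at hi
    exact none_eligible i (Or.inr ⟨hc.one_le, hi.1, Or.inr ⟨hb, hi.2.le, hm⟩⟩)
  · refine (hc.steps_le h).trans (le_of_eq ?_)
    push_cast
    ring
  · intro i hi
    by_cases hif : i ∈ c.finished
    · exact (hc.finished i hif).extend h (fun hiR => hc.unfinished i hiR hif) hc.history.agree
        (hc.start_potential_le h) (hc.end_potential_le h hk)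
    · have hb := ((hfin i).1 hi).resolve_left hif
      exact FinishedInv.of_no_move hb fun hm =>
        none_eligible i (Or.inr ⟨hc.one_le, hif, Or.inl ⟨hb, hm⟩⟩)

theorem Inv.step (h : Admissible G d γ P₀) {c c' : Config N E} (hc : Inv G d γ P₀ c)
    (hstep : Step G d γ P₀ c c') : Inv G d γ P₀ c' := by
  rcases hstep with ⟨i, S, running, eligible, best⟩ | ⟨running, none_eligible⟩
  · rcases hc with hc | ⟨Q, R, k, hk, hc⟩
    · exact Or.inl (hc.improve h eligible best)
    · refine Or.inr ⟨Q, insert i R, k, ?_, hc.improve h running eligible best⟩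
      push_cast
      linarith
  · rcases hc with hc | ⟨Q, R, k, hk, hc⟩
    · exact Or.inr ⟨_, _, _, le_rfl, hc.nextPhase h none_eligible⟩
    · exact Or.inr ⟨_, _, _, le_rfl, hc.nextPhase h hk running none_eligible⟩

theorem Reachable.inv (h : Admissible G d γ P₀) (hc : Reachable G d γ P₀ c) :
    Inv G d γ P₀ c := by
  induction hc with
  | refl => exact inv_initial h
  | tail _ hstep ih => exact ih.step h hstep

theorem Inv.steps_le (h : Admissible G d γ P₀) (hc : Inv G d γ P₀ c) :
    (c.steps : ℝ) ≤ initialSteps (Fintype.card N) d γ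
      + (Real.log (G.maxCost P₀ / G.minCost) + 2) * phaseSteps (Fintype.card N) d γ := by
  have hγ := h.pos
  have hg := h.blockRatio_pos
  have hB : 0 ≤ phaseSteps (Fintype.card N) d γ := by
    rw [phaseSteps]; positivity
  have h1 := h.numBlocks_le
  -- The subtraction in `numBlocks - 1` is truncated: phase `1` is still reached when there are no
  -- blocks.
  have h2 : (c.phase : ℝ) ≤ numBlocks G P₀ + 1 := by
    exact_mod_cast hc.phase_le.trans (by omega)
  have h3 : (c.steps : ℝ) ≤ initialSteps (Fintype.card N) d γ
      + c.phase * phaseSteps (Fintype.card N) d γ := by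
    rcases hc with hc | ⟨Q, R, k, -, hc⟩
    · have := hc.steps_le h
      rw [hc.phase]
      simpa using this
    · exact hc.steps_le h
  refine h3.trans ?_
  gcongr
  linarith

/-- Every transition raises the sum of phase and step counter by exactly one, and both counters are
bounded. -/
theorem not_exists_infinite_execution (h : Admissible G d γ P₀) :
    ¬ ∃ f : ℕ → Config N E, f 0 = initial P₀ ∧ ∀ k, Step G d γ P₀ (f k) (f (k + 1)) := by
  rintro ⟨f, h0, hf⟩
  have hreach : ∀ k, Reachable G d γ P₀ (f k) := by
    intro k
    induction k with
    | zero => rw [h0]; exact Relation.ReflTransGen.refl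
    | succ k ih => exact ih.tail (hf k)
  have hsum : ∀ k, (f k).steps + (f k).phase = k := by
    intro k
    induction k with
    | zero => rw [h0]; rfl
    | succ k ih =>
      have key : ∀ c c', Step G d γ P₀ c c' → c'.steps + c'.phase = c.steps + c.phase + 1 := by
        rintro c c' (⟨i, S, -, -, -⟩ | ⟨-, -⟩)
        · simp only; omega
        · simp only; omega
      rw [key _ _ (hf k), ih]
  obtain ⟨K, hK⟩ := exists_nat_gt (initialSteps (Fintype.card N) d γ
    + (Real.log (G.maxCost P₀ / G.minCost) + 2) * phaseSteps (Fintype.card N) d γ)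
  have h1 := ((hreach (K + (numBlocks G P₀ - 1 + 1))).inv h).steps_le h
  have h2 := ((hreach (K + (numBlocks G P₀ - 1 + 1))).inv h).phase_le
  have h3 := hsum (K + (numBlocks G P₀ - 1 + 1))
  have h4 : K ≤ (f (K + (numBlocks G P₀ - 1 + 1))).steps := by omega
  have h5 : (K : ℝ) ≤ (f (K + (numBlocks G P₀ - 1 + 1))).steps := by exact_mod_cast h4
  linarith

/-! ### Quality of the final state. -/

/-- When the player finished, at cost `X`, she had no `s`-move, and `s ≤ 2Θ`. An alternative that
costs `Y` now cost at most `2Y + Θγ²X/2` then. As `γΘ ≤ 1/4`, the error term is absorbed by `X`; her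
own cost has at most doubled since. -/
theorem FinishedInv.playerCost_le (h : Admissible G d γ P₀)
    (hγ4 : γ ≤ 1 / (4 * stretchBound d (1 + γ))) {r : ℕ} {P : N → Finset E} {i : N}
    (hi : FinishedInv G d γ P₀ r P i) {S : Finset E} (hS : S ∈ G.strategies i) :
    G.playerCost P i
      ≤ 16 * stretchBound d (1 + γ) * G.playerCost (Function.update P i S) i := by
  obtain ⟨k, Q, M, hiM, hQP, hk, hm, hc, hp⟩ := hi
  have hγ := h.pos
  have hγ1 := h.lt_quarter
  have hΘ := h.stretch_pos
  have hd : (1 : ℝ) ≤ d := by exact_mod_cast h.one_le_deg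
  have hnoMove := not_lt.1 fun hlt => hm ⟨S, hS, hlt⟩
  have halt := G.playerCost_update_le_add h.natDegree_le hQP hiM (rootGap_pos d) S
  have hY := G.playerCost_nonneg (Function.update P i S) i
  have hcd := one_add_rootGap_pow_le_two d
  have hΛ := mul_smoothCoeff_le_stretchBound h.one_le_deg (by linarith) h.stretch_pos
  have hΛ2 := two_le_smoothCoeff h.one_le_deg
  -- One factor `γ⁻¹` of the block ratio pays for the division by `γ`; the remaining `γ²` will
  -- outweigh the `Θ²` below.
  have hborder : 2 * Fintype.card N / γ * (border G d γ P₀ (k + 1) - border G d γ P₀ r)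
      ≤ γ ^ 2 * G.playerCost Q i / 2 := by
    have h1 := h.border_pos r
    have h2 := h.border_succ k
    have h2' := h.border_pos (k + 1)
    have h3 : 2 * Fintype.card N / γ * border G d γ P₀ (k + 1)
        = γ ^ 2 * border G d γ P₀ k / (d + 1) := by
      rw [← h2, blockRatio]
      field_simp
    have hn : (0 : ℝ) ≤ 2 * Fintype.card N / γ := by positivity
    have h4 := mul_le_mul_of_nonneg_left
      (show border G d γ P₀ (k + 1) - border G d γ P₀ r ≤ border G d γ P₀ (k + 1) by linarith) hn
    refine h4.trans (h3.le.trans ?_)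
    have hX := (h.border_pos k).le.trans hk
    gcongr
    linarith
  rw [← smoothCoeff] at halt
  set X := G.playerCost Q i
  set Y := G.playerCost (Function.update P i S) i
  set Z := G.playerCost (Function.update Q i S) i
  set Θ := stretchBound d (1 + γ)
  set s := sFactor d γ
  have hX : 0 ≤ X := (h.border_pos k).le.trans hk
  have hγΘ : γ * Θ ≤ 1 / 4 := by
    rw [le_div_iff₀ (by positivity)] at hγ4
    linarith
  have hs : s ≤ 2 * Θ := by
    have h1 : (2 * Θ)⁻¹ ≤ s⁻¹ := by
      have e : s⁻¹ = 1 / Θ - 2 * γ := sFactor_inv d γ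
      have e2 : (2 * Θ)⁻¹ = 1 / Θ - 1 / 2 * (1 / Θ) := by field_simp; norm_num
      have e3 : 2 * γ ≤ 1 / 2 * (1 / Θ) := by
        rw [one_div_mul_one_div, le_div_iff₀ (by positivity)]
        linarith
      rw [e, e2]
      linarith
    have hs0 : 0 < s := by linarith [h.one_lt_sFactor]
    exact (inv_le_inv₀ (by positivity) hs0).1 h1
  have hZ : Z ≤ 2 * Y + Θ * (γ ^ 2 * X / 2) := by
    have h1 := mul_le_mul_of_nonneg_right hcd hY
    have h2 : smoothCoeff d * G.partialPotential M Q ≤ Θ * (γ ^ 2 * X / 2) :=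
      mul_le_mul (by nlinarith) (hp.trans hborder) (G.partialPotential_nonneg M Q) hΘ.le
    linarith
  have hZ0 : 0 ≤ Z := G.playerCost_nonneg _ i
  have hsmall : Θ * (Θ * γ ^ 2 * X) ≤ X / 16 := by
    have : Θ * (Θ * γ ^ 2 * X) = (γ * Θ) ^ 2 * X := by ring
    rw [this]
    have : (γ * Θ) ^ 2 ≤ (1 / 4) ^ 2 := pow_le_pow_left₀ (by positivity) hγΘ 2
    nlinarith
  have hXle : X ≤ 2 * Θ * Z := hnoMove.trans (mul_le_mul_of_nonneg_right hs hZ0)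
  have hX2 : X ≤ 4 * Θ * Y + X / 16 := by
    have := mul_le_mul_of_nonneg_left hZ (show 0 ≤ 2 * Θ by linarith)
    linarith
  have hγ2 : γ ^ 2 * X / 2 ≤ X := by
    have : γ ^ 2 ≤ 1 := pow_le_one₀ hγ.le (by linarith)
    nlinarith
  linarith

/-- A halted configuration has just entered its phase, so its state is the starting state of that
phase. Finished players are covered by their invariant; the others cost at least `X_min`, hence at
least the border, and have no `t`-move. -/
theorem isApproxPNE_of_halted (h : Admissible G d γ P₀)
    (hγ4 : γ ≤ 1 / (4 * stretchBound d (1 + γ))) (hc : Inv G d γ P₀ c)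
    (hh : Halted G P₀ c) : G.IsApproxPNE (16 * stretchBound d (1 + γ)) c.state := by
  rcases hc with hc | ⟨Q, R, k, -, hc⟩
  · rw [Halted, hc.phase] at hh
    omega
  refine ⟨hc.outcome, fun i S hS => ?_⟩
  have hQ : Q = c.state := by
    have hR := hc.halted hh
    funext j
    exact hc.history.agree j (by simp [hR])
  have hY := G.playerCost_nonneg (Function.update c.state i S) i
  by_cases hi : i ∈ c.finished
  · have := hc.finished i hi
    rw [hQ] at this
    exact this.playerCost_le h hγ4 hS
  · have hb : border G d γ P₀ c.phase ≤ G.playerCost Q i := by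
      rw [hQ]
      refine (h.border_le_minCost ?_).trans (minCost_le_playerCost hc.outcome i)
      rw [Halted] at hh
      omega
    have hm := hc.start i hi hb
    rw [hQ] at hm
    refine (not_lt.1 fun hlt => hm ⟨S, hS, hlt⟩).trans ?_
    refine mul_le_mul_of_nonneg_right ?_ hY
    linarith [h.two_mul_le_stretchBound, h.pos]

end Invariants

/-- The polynomial bound on the number of improvement steps. -/
noncomputable def stepsPoly : MvPolynomial (Fin 4) ℝ :=
  2 * MvPolynomial.X 0 ^ 2 * (MvPolynomial.X 1 + 1) * MvPolynomial.X 2 ^ 3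
    * (MvPolynomial.X 2 + 1) * (1 + (MvPolynomial.X 3 + 2) * MvPolynomial.X 2)

theorem eval_stepsPoly (n d : ℕ) {γ : ℝ} (hγ : 0 < γ) (L : ℝ) :
    MvPolynomial.eval ![(n : ℝ), (d : ℝ), 1 / γ, L] stepsPoly
      = initialSteps n d γ + (L + 2) * phaseSteps n d γ := by
  simp [stepsPoly, initialSteps, phaseSteps, blockRatio]
  field_simp

end PhasedBestResponse

open PhasedBestResponse in
theorem mainTheorem1 :
    ∃ (p : Polynomial ℝ) (q : MvPolynomial (Fin 4) ℝ),
      ∀ (N E : Type*) [Fintype N] [Nonempty N] [DecidableEq N] [Fintype E] [DecidableEq E]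
        (G : CongestionGame N E) (d : ℕ) (γ : ℝ) (P₀ : N → Finset E),
        1 ≤ d → (∀ e, (G.cost e).natDegree ≤ d) →
        G.IsOutcome P₀ → 0 < G.minCost →
        0 < γ → 0 < stretchBound d (1 + γ) → γ < 1 / (2 * stretchBound d (1 + γ)) →
        -- every execution terminates
        (¬ ∃ f : ℕ → PhasedBestResponse.Config N E, f 0 = PhasedBestResponse.initial P₀ ∧
          ∀ k, PhasedBestResponse.Step G d γ P₀ (f k) (f (k + 1))) ∧
        -- the number of improvement steps is polynomial in `n`, `d`, `1/γ`, `log (X_max / X_min)`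
        (∀ c, PhasedBestResponse.Reachable G d γ P₀ c →
          (c.steps : ℝ) ≤ MvPolynomial.eval
            ![(Fintype.card N : ℝ), (d : ℝ), 1 / γ, Real.log (G.maxCost P₀ / G.minCost)] q) ∧
        -- executions end only after the last phase, in an approximate equilibrium if `γ` is small
        (∀ c, PhasedBestResponse.Reachable G d γ P₀ c →
          (∀ c', ¬ PhasedBestResponse.Step G d γ P₀ c c') →
          PhasedBestResponse.Halted G P₀ c ∧
          (γ ≤ 1 / (4 * stretchBound d (1 + γ)) →
            G.IsApproxPNE (((d : ℝ) / Real.log 2) ^ d * p.eval (d : ℝ)) c.state)) := by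
  -- The first witness is the polynomial factor in the estimate of `16Θ`.
  refine ⟨48 * (Polynomial.X + 1) ^ 3 * (Polynomial.X + 3), stepsPoly, ?_⟩
  intro N E _ _ _ _ _ G d γ P₀ hd1 hd hP₀ hmin hγ hΘ hγΘ
  have h : Admissible G d γ P₀ := ⟨hd1, hd, hP₀, hmin, hγ, hΘ, hγΘ⟩
  refine ⟨not_exists_infinite_execution h, fun c hc => ?_, fun c hc hstep => ?_⟩
  · rw [eval_stepsPoly _ _ hγ]
    exact (hc.inv h).steps_le h
  · have hh := halted_of_no_step hstep
    refine ⟨hh, fun hγ4 => ?_⟩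
    obtain ⟨ho, hne⟩ := isApproxPNE_of_halted h hγ4 (hc.inv h) hh
    refine ⟨ho, fun i S hS => (hne i S hS).trans ?_⟩
    refine mul_le_mul_of_nonneg_right ?_ (G.playerCost_nonneg _ i)
    refine (stretchBound_le hd1 hγ hΘ hγ4).trans (le_of_eq ?_)
    simp
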